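/- Let $X$ be an integral projective scheme of dimension $n\ge 1$ over an arbitrary field $k$, with function field $k(X)$. For a Cartier divisor $D$ on $X$ let $L(X,D)=\{0\}\cup\{f\in k(X)^{\times}: (f)+D \text{ is effective}\}$, and define the volume $$\mathrm{vol}(D)=n!\,\limsup_{m\to\infty}\frac{\dim_k L(X,mD)}{m^n}\in[0,\infty].$$ Call $D$ big if $\mathrm{vol}(D)>0$. Then $\mathrm{vol}^{1/n}$ is concave on big divisors: for any two Cartier divisors $D_1,D_2$ on $X$ with $\mathrm{vol}(D_1)>0$ and $\mathrm{vol}(D_2)>0$, $$\mathrm{vol}(D_1+D_2)^{1/n}\ \ge\ \mathrm{vol}(D_1)^{1/n}+\mathrm{vol}(D_2)^{1/n},$$ and more generally, for all integers $p,q\ge 0$, $$\mathrm{vol}(pD_1+qD_2)^{1/n}\ \ge\ p\,\mathrm{vol}(D_1)^{1/n}+q\,\mathrm{vol}(D_2)^{1/n}.$$ -/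

import Mathlib

open AlgebraicGeometry CategoryTheory

universe u

noncomputable section

namespace BigDivisor

attribute [local instance] MvPolynomial.gradedAlgebra

/-- Projective space `ℙ^N` over a field `k`, as `Proj k[x₀, …, x_N]`. -/
abbrev projSpace (k : Type u) [Field k] (N : ℕ) : Scheme.{u} :=
  Proj (MvPolynomial.homogeneousSubmodule (Fin (N + 1)) k)

/-- The structure morphism `ℙ^N ⟶ Spec k`. -/
def projSpaceToSpec (k : Type u) [Field k] (N : ℕ) :
    projSpace k N ⟶ Spec (CommRingCat.of k) :=
  Proj.toSpecZero (MvPolynomial.homogeneousSubmodule (Fin (N + 1)) k) ≫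
    Spec.map (CommRingCat.ofHom
      (algebraMap k (MvPolynomial.homogeneousSubmodule (Fin (N + 1)) k 0)))

/-- A `k`-scheme `π : X ⟶ Spec k` is projective if it is isomorphic over `k` to a closed
subscheme of some `ℙ^N`. -/
def IsProjectiveOver {k : Type u} [Field k] {X : Scheme.{u}}
    (π : X ⟶ Spec (CommRingCat.of k)) : Prop :=
  ∃ (N : ℕ) (i : X ⟶ projSpace k N), IsClosedImmersion i ∧ i ≫ projSpaceToSpec k N = π

section Cartier

variable (X : Scheme.{u}) [IsIntegral X]

/-- The image of `𝒪_{X,x}ˣ` in `k(X)ˣ`. -/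
def localUnits (x : X) : Subgroup (X.functionField)ˣ :=
  (Units.map (algebraMap (X.presheaf.stalk x) X.functionField).toMonoidHom).range

/-- Global sections of the sheaf `𝒦ˣ/𝒪ˣ` on an integral scheme (where `𝒦` is the constant sheaf
`k(X)`): families of germs in `k(X)ˣ/𝒪_{X,x}ˣ` which, locally on `X`, come from one rational
function. -/
def cartierSubgroup : Subgroup (∀ x : X, (X.functionField)ˣ ⧸ localUnits X x) where
  carrier := {D | ∀ x : X, ∃ U : X.Opens, x ∈ U ∧ ∃ d : (X.functionField)ˣ,
    ∀ y ∈ U, D y = QuotientGroup.mk d}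
  one_mem' := fun _ => ⟨⊤, trivial, 1, fun _ _ => rfl⟩
  mul_mem' := by
    intro D E hD hE x
    obtain ⟨U, hxU, d, hd⟩ := hD x
    obtain ⟨V, hxV, e, he⟩ := hE x
    refine ⟨U ⊓ V, ⟨hxU, hxV⟩, d * e, fun y hy => ?_⟩
    rw [Pi.mul_apply, hd y hy.1, he y hy.2]
    rfl
  inv_mem' := by
    intro D hD x
    obtain ⟨U, hxU, d, hd⟩ := hD x
    refine ⟨U, hxU, d⁻¹, fun y hy => ?_⟩
    rw [Pi.inv_apply, hd y hy]
    rfl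

/-- The group of (integral) Cartier divisors on `X`, written additively. -/
abbrev CartierDivisor : Type u := Additive (cartierSubgroup X)

variable {X}

/-- The rational function `d` is a local equation of `D` at `x`. -/
def IsLocalEquation (D : CartierDivisor X) (x : X) (d : (X.functionField)ˣ) : Prop :=
  (D.toMul : ∀ x : X, (X.functionField)ˣ ⧸ localUnits X x) x = QuotientGroup.mk d

end Cartier

section Volume

variable {k : Type u} [Field k] {X : Scheme.{u}} [IsIntegral X]

/-- The constants: `k → Γ(X, 𝒪_X)`, induced by `π : X ⟶ Spec k`. -/
def constants (π : X ⟶ Spec (CommRingCat.of k)) : k →+* Γ(X, ⊤) :=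
  ((Scheme.ΓSpecIso (CommRingCat.of k)).inv ≫ π.appTop).hom

/-- The `k`-algebra structure of the function field of a `k`-scheme. -/
abbrev functionFieldAlgebra (π : X ⟶ Spec (CommRingCat.of k)) : Algebra k X.functionField :=
  ((X.presheaf.germ ⊤ (genericPoint X) trivial).hom.comp (constants π)).toAlgebra

/-- `L(X, D) = {f ∈ k(X) : f = 0 or (f) + D ≥ 0}`: the rational functions `f` such that, at every
point `x`, `f * d` is regular for a local equation `d` of `D` at `x`. -/
def sections (π : X ⟶ Spec (CommRingCat.of k)) (D : CartierDivisor X) :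
    @Submodule k X.functionField _ _ (functionFieldAlgebra π).toModule :=
  letI := functionFieldAlgebra π
  { carrier := {f | ∀ (x : X) (d : (X.functionField)ˣ), IsLocalEquation D x d →
      f * d ∈ (algebraMap (X.presheaf.stalk x) X.functionField).range}
    zero_mem' := fun x d _ => by rw [zero_mul]; exact zero_mem _
    add_mem' := fun hf hg x d hd => by rw [add_mul]; exact add_mem (hf x d hd) (hg x d hd)
    smul_mem' := fun c f hf x d hd => by
      rw [Algebra.smul_def, mul_assoc]
      refine mul_mem ⟨X.presheaf.germ ⊤ x trivial (constants π c), ?_⟩ (hf x d hd)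
      have : Nonempty (⊤ : X.Opens) := ⟨⟨genericPoint X, trivial⟩⟩
      exact Scheme.algebraMap_germ_eq_germToFunctionField X (U := ⊤) (x := x) trivial (constants π c) }

/-- `dim_k L(X, D)`, as an element of `ℕ ∪ {∞}`. -/
def dimSections (π : X ⟶ Spec (CommRingCat.of k)) (D : CartierDivisor X) : ℕ∞ :=
  letI := functionFieldAlgebra π
  Cardinal.toENat (Module.rank k (sections π D))

/-- The volume `n! · limsup_m dim_k L(X, mD) / m ^ n ∈ [0, ∞]` of a Cartier divisor on an
`n`-dimensional variety. -/
def vol (π : X ⟶ Spec (CommRingCat.of k)) (n : ℕ) (D : CartierDivisor X) : ENNReal :=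
  (n.factorial : ENNReal) *
    Filter.limsup (fun m : ℕ => (dimSections π (m • D) : ENNReal) / (m : ENNReal) ^ n) Filter.atTop

end Volume

end BigDivisor

end

/-! Let `v` be a discrete valuation of a finitely generated field `K / k` whose residue field has
transcendence degree one less than `K`. The dimension of a subspace of `K` is the sum over `i` of
the dimensions of its spaces of leading coefficients of order `i`, and leading coefficients
multiply. By induction on the transcendence degree `d` this yields a linear Brunn–Minkowski
inequality: some finite-dimensional `E` satisfies
`dim (E V W) ^ (1 / d) ≥ dim V ^ (1 / d) + dim W ^ (1 / d)` for all nonzero `V` and `W`.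

Let `L m` be the space of sections of `m (p D₁ + q D₂)` and apply this over the field generated by
the ratios of elements of the `L m`, to the products of sections of `m p D₁` and `m q D₂`. Here `E`
becomes a subspace of some fixed `L a` after multiplication by an element of it, so it only shifts
`m` by `a`, and the shift disappears in the limit. Finally, the `n`-th root of `dim L m` is, up to
bounded shifts, superadditive in `m`, so that the upper limits in the volumes can be compared along
the multiples of a fixed degree. -/

noncomputable section

namespace BigDivisor

/-! ### The one-variable Brunn–Minkowski inequality -/

section BrunnMinkowskiSum

/-- The Brunn–Minkowski sum `(a ^ (1 / d) + b ^ (1 / d)) ^ d` of two volumes in dimension `d`.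
In dimension `0` it is the limit `max a b`, which is the bound that products of subspaces of a
finite field extension satisfy. -/
def brunnMinkowskiSum : ℕ → ℝ → ℝ → ℝ
  | 0, a, b => max a b
  | d + 1, a, b => (a ^ (1 / ((d : ℝ) + 1)) + b ^ (1 / ((d : ℝ) + 1))) ^ (d + 1)

lemma brunnMinkowskiSum_mono (d : ℕ) {a a' b b' : ℝ} (ha : 0 ≤ a) (hb : 0 ≤ b) (haa' : a ≤ a')
    (hbb' : b ≤ b') : brunnMinkowskiSum d a b ≤ brunnMinkowskiSum d a' b' := by
  cases d with
  | zero => exact max_le_max haa' hbb'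
  | succ d => simp only [brunnMinkowskiSum]; gcongr

lemma brunnMinkowskiSum_pos (d : ℕ) {a b : ℝ} (ha : 0 < a) (hb : 0 < b) :
    0 < brunnMinkowskiSum d a b := by
  cases d with
  | zero => exact lt_max_of_lt_left ha
  | succ d => simp only [brunnMinkowskiSum]; positivity

lemma brunnMinkowskiSum_mul_left (d : ℕ) {s a b : ℝ} (hs : 0 ≤ s) (ha : 0 ≤ a) (hb : 0 ≤ b) :
    brunnMinkowskiSum d (s * a) (s * b) = s * brunnMinkowskiSum d a b := by
  cases d with
  | zero => exact (mul_max_of_nonneg _ _ hs).symm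
  | succ d =>
    have root_pow : (s ^ (1 / ((d : ℝ) + 1))) ^ (d + 1) = s := by
      simpa using Real.rpow_inv_natCast_pow hs d.succ_ne_zero
    simp only [brunnMinkowskiSum]
    rw [Real.mul_rpow hs ha, Real.mul_rpow hs hb, ← mul_add, mul_pow, root_pow]

/-- Radon's inequality for two summands. -/
lemma add_pow_succ_le_add_pow_mul (d : ℕ) {p q a b : ℝ} (hp : 0 < p) (hq : 0 < q) (ha : 0 ≤ a)
    (hb : 0 ≤ b) :
    (a + b) ^ (d + 1) ≤ (p + q) ^ d * (a ^ (d + 1) / p ^ d + b ^ (d + 1) / q ^ d) := by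
  have convexity := (convexOn_pow (d + 1)).2 (div_nonneg ha hp.le) (div_nonneg hb hq.le)
    (by positivity : 0 ≤ p / (p + q)) (by positivity : 0 ≤ q / (p + q)) (by field_simp)
  simp only [smul_eq_mul] at convexity
  have mean_eq : p / (p + q) * (a / p) + q / (p + q) * (b / q) = (a + b) / (p + q) := by
    field_simp
  rw [mean_eq, div_pow, div_le_iff₀ (by positivity)] at convexity
  refine convexity.trans_eq ?_
  simp only [div_pow, pow_succ]
  field_simp

lemma brunnMinkowskiSum_succ_le_mul (d : ℕ) {x y a b : ℝ} (hx : 0 < x) (hy : 0 < y) (ha : 0 ≤ a)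
    (hb : 0 ≤ b) :
    brunnMinkowskiSum (d + 1) a b ≤ brunnMinkowskiSum d x y * (a / x + b / y) := by
  cases d with
  | zero =>
    have ratio_le {z c m : ℝ} (hz : 0 < z) (hc : 0 ≤ c) (hzm : z ≤ m) : c ≤ m * (c / z) := by
      rw [← mul_div_assoc, le_div_iff₀ hz, mul_comm]
      gcongr
    have ha' := ratio_le hx ha (le_max_left x y)
    have hb' := ratio_le hy hb (le_max_right x y)
    norm_num [brunnMinkowskiSum]
    linarith
  | succ d =>
    have root_pow (m : ℕ) {z : ℝ} (hz : 0 ≤ z) : (z ^ (1 / ((m : ℝ) + 1))) ^ (m + 1) = z := by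
      simpa using Real.rpow_inv_natCast_pow hz m.succ_ne_zero
    have radon := add_pow_succ_le_add_pow_mul (d + 1)
      (Real.rpow_pos_of_pos hx (1 / ((d : ℝ) + 1))) (Real.rpow_pos_of_pos hy (1 / ((d : ℝ) + 1)))
      (Real.rpow_nonneg ha (1 / (((d + 1 : ℕ) : ℝ) + 1)))
      (Real.rpow_nonneg hb (1 / (((d + 1 : ℕ) : ℝ) + 1)))
    rwa [root_pow _ ha, root_pow _ hb, root_pow _ hx.le, root_pow _ hy.le] at radon

open MeasureTheory in
lemma sum_ofReal_min_one_eq_lintegral_card {ι : Type*} (s : Finset ι) (f : ι → ℝ) :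
    ∑ i ∈ s, ENNReal.ofReal (min (f i) 1) =
      ∫⁻ σ in Set.Ioc (0 : ℝ) 1, ((s.filter fun i => σ ≤ f i).card : ENNReal) := by
  have layer (i : ι) : ENNReal.ofReal (min (f i) 1) =
      ∫⁻ σ in Set.Ioc (0 : ℝ) 1, (Set.Iic (f i)).indicator 1 σ := by
    rw [lintegral_indicator_one measurableSet_Iic, Measure.restrict_apply measurableSet_Iic,
      Set.inter_comm, Set.Ioc_inter_Iic, Real.volume_Ioc, sub_zero, min_comm]
  simp_rw [layer]
  rw [← lintegral_finsetSum _ fun i _ => measurable_one.indicator measurableSet_Iic]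
  refine lintegral_congr fun σ => ?_
  rw [Finset.card_filter, Nat.cast_sum]
  exact Finset.sum_congr rfl fun i _ => by simp [Set.indicator_apply]

lemma sum_min_one_add_sum_min_one_le {ι : Type*} {s t u : Finset ι} {f g h : ι → ℝ}
    (hf : ∀ i, 0 ≤ f i) (hg : ∀ i, 0 ≤ g i) (hh : ∀ i, 0 ≤ h i)
    (hcard : ∀ σ : ℝ, 0 < σ → σ ≤ 1 → (s.filter fun i => σ ≤ f i).card +
      (t.filter fun i => σ ≤ g i).card ≤ (u.filter fun i => σ ≤ h i).card) :
    ∑ i ∈ s, min (f i) 1 + ∑ i ∈ t, min (g i) 1 ≤ ∑ i ∈ u, min (h i) 1 := by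
  have min_nonneg {f : ι → ℝ} (hf : ∀ i, 0 ≤ f i) (i : ι) : 0 ≤ min (f i) 1 :=
    le_min (hf i) zero_le_one
  have sum_nonneg {f : ι → ℝ} (hf : ∀ i, 0 ≤ f i) (w : Finset ι) : 0 ≤ ∑ i ∈ w, min (f i) 1 :=
    Finset.sum_nonneg fun i _ => min_nonneg hf i
  rw [← ENNReal.ofReal_le_ofReal_iff (sum_nonneg hh u),
    ENNReal.ofReal_add (sum_nonneg hf s) (sum_nonneg hg t),
    ENNReal.ofReal_sum_of_nonneg fun i _ => min_nonneg hf i,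
    ENNReal.ofReal_sum_of_nonneg fun i _ => min_nonneg hg i,
    ENNReal.ofReal_sum_of_nonneg fun i _ => min_nonneg hh i]
  simp only [sum_ofReal_min_one_eq_lintegral_card]
  refine (MeasureTheory.le_lintegral_add _ _).trans ?_
  exact MeasureTheory.setLIntegral_mono' measurableSet_Ioc fun σ hσ =>
    mod_cast hcard σ hσ.1 hσ.2

open Pointwise in
lemma card_add_card_le_of_add_mem {A B C : Finset ℤ} (hA : A.Nonempty) (hB : B.Nonempty)
    (hC : ∀ i ∈ A, ∀ j ∈ B, i + j ∈ C ∧ i + j + 1 ∈ C) : A.card + B.card ≤ C.card := by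
  have subset : A + B + {0, 1} ⊆ C := by
    intro l hl
    obtain ⟨_, hij, ε, hε, rfl⟩ := Finset.mem_add.mp hl
    obtain ⟨i, hi, j, hj, rfl⟩ := Finset.mem_add.mp hij
    obtain rfl | rfl : ε = 0 ∨ ε = 1 := by simpa using hε
    · simpa using (hC i hi j hj).1
    · exact (hC i hi j hj).2
  have card_AB := cauchy_davenport_add_of_linearOrder_isCancelAdd hA hB
  have card_AB01 := cauchy_davenport_add_of_linearOrder_isCancelAdd (hA.add hB)
    (Finset.insert_nonempty (0 : ℤ) {1})
  have card_01 : ({0, 1} : Finset ℤ).card = 2 := rfl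
  have := Finset.card_le_card subset
  have := hA.card_pos
  have := hB.card_pos
  omega

lemma sum_min_div_one_eq {ι : Type*} {s : Finset ι} {f : ι → ℝ} {c : ℝ} (hc : 0 < c)
    (hf : ∀ i ∈ s, f i ≤ c) : ∑ i ∈ s, min (f i / c) 1 = (∑ i ∈ s, f i) / c := by
  rw [Finset.sum_div]
  exact Finset.sum_congr rfl fun i hi => min_eq_left ((div_le_one hc).mpr (hf i hi))

-- Normalise `a`, `b` by their maxima `x`, `y` and `c` by `brunnMinkowskiSum d x y`. By homogeneity
-- the superlevel sets then satisfy `A + B + {0, 1} ⊆ C` at every height, so the layer-cake formula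
-- gives `∑ a / x + ∑ b / y ≤ ∑ c / brunnMinkowskiSum d x y`, and Radon's inequality concludes.
theorem brunnMinkowskiSum_succ_sum_le (d : ℕ) {s t u : Finset ℤ} {a b c : ℤ → ℝ}
    (ha : ∀ i, 0 ≤ a i) (hb : ∀ i, 0 ≤ b i) (hc : ∀ i, 0 ≤ c i)
    (ha_pos : ∃ i ∈ s, 0 < a i) (hb_pos : ∃ i ∈ t, 0 < b i)
    (h : ∀ i ∈ s, ∀ j ∈ t, 0 < a i → 0 < b j → ∀ l ∈ ({i + j, i + j + 1} : Finset ℤ),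
      l ∈ u ∧ brunnMinkowskiSum d (a i) (b j) ≤ c l) :
    brunnMinkowskiSum (d + 1) (∑ i ∈ s, a i) (∑ i ∈ t, b i) ≤ ∑ i ∈ u, c i := by
  obtain ⟨i₁, hi₁, hai₁⟩ := ha_pos
  obtain ⟨j₁, hj₁, hbj₁⟩ := hb_pos
  obtain ⟨i₀, hi₀, hmax_a⟩ := s.exists_max_image a ⟨i₁, hi₁⟩
  obtain ⟨j₀, hj₀, hmax_b⟩ := t.exists_max_image b ⟨j₁, hj₁⟩
  have hx : 0 < a i₀ := hai₁.trans_le (hmax_a _ hi₁)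
  have hy : 0 < b j₀ := hbj₁.trans_le (hmax_b _ hj₁)
  set z := brunnMinkowskiSum d (a i₀) (b j₀) with hz_def
  have hz : 0 < z := brunnMinkowskiSum_pos d hx hy
  have normalized : ∑ i ∈ s, min (a i / a i₀) 1 + ∑ i ∈ t, min (b i / b j₀) 1 ≤
      ∑ i ∈ u, min (c i / z) 1 := by
    refine sum_min_one_add_sum_min_one_le (fun i => div_nonneg (ha i) hx.le)
      (fun i => div_nonneg (hb i) hy.le) (fun i => div_nonneg (hc i) hz.le) fun σ hσ hσ1 => ?_
    refine card_add_card_le_of_add_mem ⟨i₀, by simp [hi₀, hx.ne', hσ1]⟩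
      ⟨j₀, by simp [hj₀, hy.ne', hσ1]⟩ fun i hi j hj => ?_
    simp only [Finset.mem_filter, le_div_iff₀ hx, le_div_iff₀ hy, le_div_iff₀ hz] at hi hj ⊢
    have level : σ * z ≤ brunnMinkowskiSum d (a i) (b j) := by
      rw [hz_def, ← brunnMinkowskiSum_mul_left d hσ.le hx.le hy.le]
      exact brunnMinkowskiSum_mono d (by positivity) (by positivity) hi.2 hj.2
    have mem_level := h i hi.1 j hj.1 ((mul_pos hσ hx).trans_le hi.2)
      ((mul_pos hσ hy).trans_le hj.2)
    exact ⟨(mem_level _ (by simp)).imp_right level.trans,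
      (mem_level _ (by simp)).imp_right level.trans⟩
  rw [sum_min_div_one_eq hx hmax_a, sum_min_div_one_eq hy hmax_b] at normalized
  have truncation : ∑ i ∈ u, min (c i / z) 1 ≤ (∑ i ∈ u, c i) / z := by
    rw [Finset.sum_div]
    exact Finset.sum_le_sum fun i _ => min_le_left _ _
  calc brunnMinkowskiSum (d + 1) (∑ i ∈ s, a i) (∑ i ∈ t, b i)
      ≤ z * ((∑ i ∈ s, a i) / a i₀ + (∑ i ∈ t, b i) / b j₀) :=
        brunnMinkowskiSum_succ_le_mul d hx hy (Finset.sum_nonneg fun i _ => ha i)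
          (Finset.sum_nonneg fun i _ => hb i)
    _ ≤ z * ((∑ i ∈ u, c i) / z) := by gcongr; exact normalized.trans truncation
    _ = ∑ i ∈ u, c i := mul_div_cancel₀ _ hz.ne'

end BrunnMinkowskiSum

/-! ### Leading terms along a discrete valuation -/

section Products

variable {k K : Type*} [Field k] [CommRing K] [Algebra k K]

instance finiteDimensional_mul (V W : Submodule k K) [hV : FiniteDimensional k V]
    [hW : FiniteDimensional k W] : FiniteDimensional k (V * W : Submodule k K) :=
  Module.Finite.iff_fg.mpr ((Module.Finite.iff_fg.mp hV).mul (Module.Finite.iff_fg.mp hW))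

instance finiteDimensional_pow (V : Submodule k K) [hV : FiniteDimensional k V] (n : ℕ) :
    FiniteDimensional k (V ^ n : Submodule k K) :=
  Module.Finite.iff_fg.mpr ((Module.Finite.iff_fg.mp hV).pow n)

end Products

/-- The linear Brunn–Minkowski property of dimension `d` of a field extension `K / k`:
`dim (E V W) ^ (1 / d) ≥ dim V ^ (1 / d) + dim W ^ (1 / d)` for all nonzero finite-dimensional
subspaces `V` and `W`, where the finite-dimensional `E` does not depend on them. -/
def HasLinearBrunnMinkowski (d : ℕ) (k K : Type*) [Field k] [Field K] [Algebra k K] : Prop :=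
  ∃ E : Submodule k K, FiniteDimensional k E ∧ ∀ V W : Submodule k K, FiniteDimensional k V →
    FiniteDimensional k W → V ≠ ⊥ → W ≠ ⊥ →
    brunnMinkowskiSum d (Module.finrank k V) (Module.finrank k W) ≤
      Module.finrank k (E * V * W : Submodule k K)

lemma finrank_map_add_finrank_inf_ker {k M N : Type*} [Field k] [AddCommGroup M] [Module k M]
    [AddCommGroup N] [Module k N] (f : M →ₗ[k] N) (P : Submodule k M) [FiniteDimensional k P] :
    Module.finrank k (P.map f) + Module.finrank k (P ⊓ LinearMap.ker f : Submodule k M) =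
      Module.finrank k P := by
  rw [← LinearMap.finrank_range_add_finrank_ker (f.domRestrict P), LinearMap.range_domRestrict,
    LinearMap.ker_domRestrict, ← Submodule.finrank_map_subtype_eq P, Submodule.map_comap_subtype]

section ValuationOrder

variable {k O K : Type*} [Field k] [CommRing O] [Field K]
  [Algebra k O] [Algebra O K] [Algebra k K] [IsScalarTower k O K]

variable (k K) in
/-- The map `z ↦ z ϖ ^ i`. For a uniformizer `ϖ` it identifies the valuation ring `O` with the
elements of `K` of order at least `i`. -/
def mulZPow (ϖ : O) (i : ℤ) : O →ₗ[k] K :=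
  LinearMap.mulRight k (algebraMap O K ϖ ^ i) ∘ₗ (IsScalarTower.toAlgHom k O K).toLinearMap

lemma mulZPow_apply (ϖ : O) (i : ℤ) (z : O) :
    mulZPow k K ϖ i z = algebraMap O K z * algebraMap O K ϖ ^ i := rfl

variable [IsFractionRing O K] {ϖ : O} (hϖ : ϖ ≠ 0)

include hϖ

lemma mulZPow_injective (i : ℤ) : Function.Injective (mulZPow k K ϖ i) := fun _ _ hxy =>
  IsFractionRing.injective O K (mul_right_cancel₀
    (zpow_ne_zero i ((map_ne_zero_iff _ (IsFractionRing.injective O K)).mpr hϖ)) hxy)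

lemma mulZPow_add_mul (i j : ℤ) (x y : O) :
    mulZPow k K ϖ (i + j) (x * y) = mulZPow k K ϖ i x * mulZPow k K ϖ j y := by
  simp only [mulZPow_apply, map_mul,
    zpow_add₀ ((map_ne_zero_iff _ (IsFractionRing.injective O K)).mpr hϖ)]
  ring

lemma mulZPow_mul_pow (i : ℤ) (n : ℕ) (z : O) :
    mulZPow k K ϖ i (z * ϖ ^ n) = mulZPow k K ϖ (i + n) z := by
  simp only [mulZPow_apply, map_mul, map_pow, zpow_natCast,
    zpow_add₀ ((map_ne_zero_iff _ (IsFractionRing.injective O K)).mpr hϖ)]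
  ring

lemma mulZPow_mul_self (i : ℤ) (z : O) :
    mulZPow k K ϖ i (z * ϖ) = mulZPow k K ϖ (i + 1) z := by
  simpa only [pow_one, Nat.cast_one] using mulZPow_mul_pow hϖ i 1 z

lemma antitone_range_mulZPow : Antitone fun i : ℤ => LinearMap.range (mulZPow k K ϖ i) := by
  refine antitone_int_of_succ_le fun i => ?_
  rintro _ ⟨z, rfl⟩
  exact ⟨z * ϖ, mulZPow_mul_self hϖ i z⟩

lemma restrict_mulZPow_injective (i : ℤ) (V : Submodule k K) :
    Function.Injective ((mulZPow k K ϖ i).restrict (fun _ hz => hz) :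
      V.comap (mulZPow k K ϖ i) →ₗ[k] V) :=
  fun _ _ h => Subtype.ext (mulZPow_injective hϖ i (congrArg Subtype.val h))

lemma finiteDimensional_comap_mulZPow (i : ℤ) (V : Submodule k K) [FiniteDimensional k V] :
    FiniteDimensional k (V.comap (mulZPow k K ϖ i)) :=
  Module.Finite.of_injective _ (restrict_mulZPow_injective hϖ i V)

lemma finrank_comap_mulZPow_le (i : ℤ) (V : Submodule k K) [FiniteDimensional k V] :
    Module.finrank k (V.comap (mulZPow k K ϖ i)) ≤ Module.finrank k V :=
  LinearMap.finrank_le_finrank_of_injective (restrict_mulZPow_injective hϖ i V)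

end ValuationOrder

section LeadingCoefficients

open IsLocalRing (ResidueField residue)

variable {k O K : Type*} [Field k] [CommRing O] [IsDomain O] [IsDiscreteValuationRing O] [Field K]
  [Algebra k O] [Algebra O K] [Algebra k K] [IsScalarTower k O K]

variable (k O) in
/-- The reduction map of the valuation ring, as a linear map over the constants. -/
def reduction : O →ₗ[k] ResidueField O :=
  (IsScalarTower.toAlgHom k O (ResidueField O)).toLinearMap

/-- The coefficients of `ϖ ^ i` in the elements of `V` of order at least `i`, for a uniformizer
`ϖ`. -/
def leadingCoeffs (ϖ : O) (i : ℤ) (V : Submodule k K) : Submodule k (ResidueField O) :=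
  (V.comap (mulZPow k K ϖ i)).map (reduction k O)

lemma leadingCoeffs_mono (ϖ : O) (i : ℤ) {V W : Submodule k K} (hVW : V ≤ W) :
    leadingCoeffs ϖ i V ≤ leadingCoeffs ϖ i W :=
  Submodule.map_mono (Submodule.comap_mono hVW)

lemma exists_le_leadingCoeffs (ϖ : O) (i : ℤ) (E : Submodule k (ResidueField O))
    [FiniteDimensional k E] :
    ∃ E' : Submodule k K, FiniteDimensional k E' ∧ E ≤ leadingCoeffs ϖ i E' := by
  obtain ⟨s, rfl⟩ := Module.Finite.iff_fg.mp (inferInstance : Module.Finite k E)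
  choose lift hlift using IsLocalRing.residue_surjective (R := O)
  classical
  refine ⟨Submodule.span k (s.image (mulZPow k K ϖ i ∘ lift)), inferInstance,
    Submodule.span_le.mpr fun e he => ⟨lift e, ?_, hlift e⟩⟩
  exact Submodule.subset_span (Finset.mem_image_of_mem _ he)

lemma exists_le_leadingCoeffs_zero_one (ϖ : O) (E : Submodule k (ResidueField O))
    [FiniteDimensional k E] :
    ∃ E' : Submodule k K, FiniteDimensional k E' ∧
      ∀ ε : ℤ, ε = 0 ∨ ε = 1 → E ≤ leadingCoeffs ϖ ε E' := by
  obtain ⟨E₀, _, hE₀⟩ := exists_le_leadingCoeffs (K := K) ϖ 0 E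
  obtain ⟨E₁, _, hE₁⟩ := exists_le_leadingCoeffs (K := K) ϖ 1 E
  refine ⟨E₀ ⊔ E₁, inferInstance, ?_⟩
  rintro ε (rfl | rfl)
  · exact hE₀.trans (leadingCoeffs_mono ϖ 0 le_sup_left)
  · exact hE₁.trans (leadingCoeffs_mono ϖ 1 le_sup_right)

variable {ϖ : O}

lemma mem_ker_reduction_iff_dvd (hϖ : Irreducible ϖ) {z : O} :
    z ∈ LinearMap.ker (reduction k O) ↔ ϖ ∣ z := by
  change residue O z = 0 ↔ ϖ ∣ z
  rw [IsLocalRing.residue_eq_zero_iff, hϖ.maximalIdeal_eq, Ideal.mem_span_singleton]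

variable [IsFractionRing O K]

lemma finiteDimensional_leadingCoeffs (hϖ : ϖ ≠ 0) (i : ℤ) (V : Submodule k K)
    [FiniteDimensional k V] : FiniteDimensional k (leadingCoeffs ϖ i V) :=
  have := finiteDimensional_comap_mulZPow hϖ i V
  inferInstanceAs (FiniteDimensional k ((V.comap (mulZPow k K ϖ i)).map (reduction k O)))

lemma leadingCoeffs_mul_le (hϖ : ϖ ≠ 0) (i j : ℤ) (V W : Submodule k K) :
    leadingCoeffs ϖ i V * leadingCoeffs ϖ j W ≤ leadingCoeffs ϖ (i + j) (V * W) := by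
  refine Submodule.mul_le.mpr ?_
  rintro _ ⟨x, hx, rfl⟩ _ ⟨y, hy, rfl⟩
  refine ⟨x * y, ?_, map_mul (residue O) x y⟩
  rw [SetLike.mem_coe, Submodule.mem_comap, mulZPow_add_mul hϖ]
  exact Submodule.mul_mem_mul hx hy

variable (hϖ : Irreducible ϖ)

include hϖ

lemma finrank_comap_mulZPow (i : ℤ) (V : Submodule k K) [FiniteDimensional k V] :
    Module.finrank k (V.comap (mulZPow k K ϖ i)) = Module.finrank k (leadingCoeffs ϖ i V) +
      Module.finrank k (V.comap (mulZPow k K ϖ (i + 1))) := by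
  have := finiteDimensional_comap_mulZPow hϖ.ne_zero i V
  rw [leadingCoeffs, ← finrank_map_add_finrank_inf_ker (reduction k O)]
  congr 1
  have vanishing : V.comap (mulZPow k K ϖ i) ⊓ LinearMap.ker (reduction k O) =
      (V.comap (mulZPow k K ϖ (i + 1))).map (LinearMap.mulRight k ϖ) := by
    ext z
    simp only [Submodule.mem_inf, mem_ker_reduction_iff_dvd hϖ, Submodule.mem_map,
      Submodule.mem_comap, LinearMap.mulRight_apply]
    constructor
    · rintro ⟨hz, w, rfl⟩
      rw [mul_comm, mulZPow_mul_self hϖ.ne_zero] at hz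
      exact ⟨w, hz, mul_comm _ _⟩
    · rintro ⟨w, hw, rfl⟩
      exact ⟨by rwa [mulZPow_mul_self hϖ.ne_zero], Dvd.intro_left w rfl⟩
  rw [vanishing]
  exact (Submodule.equivMapOfInjective _ (mul_left_injective₀ hϖ.ne_zero) _).finrank_eq.symm

lemma sum_finrank_leadingCoeffs_add (V : Submodule k K) [FiniteDimensional k V] (a : ℤ) (n : ℕ) :
    ∑ i ∈ Finset.Ico a (a + n), Module.finrank k (leadingCoeffs ϖ i V) +
      Module.finrank k (V.comap (mulZPow k K ϖ (a + n))) =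
      Module.finrank k (V.comap (mulZPow k K ϖ a)) := by
  induction n with
  | zero => rw [Nat.cast_zero, add_zero, Finset.Ico_self, Finset.sum_empty, zero_add]
  | succ n ih =>
    rw [← ih, finrank_comap_mulZPow hϖ (a + n) V, Nat.cast_succ, ← add_assoc,
      ← Finset.insert_Ico_right_eq_Ico_add_one (by omega), Finset.sum_insert (by simp)]
    ring

lemma sum_finrank_leadingCoeffs_le (V : Submodule k K) [FiniteDimensional k V] (a : ℤ) (n : ℕ) :
    ∑ i ∈ Finset.Ico a (a + n), Module.finrank k (leadingCoeffs ϖ i V) ≤ Module.finrank k V :=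
  (Nat.le_add_right _ _).trans ((sum_finrank_leadingCoeffs_add hϖ V a n).trans_le
    (finrank_comap_mulZPow_le hϖ.ne_zero a V))

lemma exists_mem_range_mulZPow (z : K) : ∃ i : ℤ, z ∈ LinearMap.range (mulZPow k K ϖ i) := by
  obtain ⟨x, y, hy, rfl⟩ := IsFractionRing.div_surjective (A := O) z
  obtain ⟨n, u, hu⟩ := IsDiscreteValuationRing.associated_pow_irreducible
    (nonZeroDivisors.ne_zero hy) hϖ
  have hy' : algebraMap O K y ≠ 0 :=
    (map_ne_zero_iff _ (IsFractionRing.injective O K)).mpr (nonZeroDivisors.ne_zero hy)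
  have hu' : algebraMap O K u ≠ 0 := (u.isUnit.map (algebraMap O K)).ne_zero
  refine ⟨-n, x * u, ?_⟩
  rw [mulZPow_apply, zpow_neg, zpow_natCast, ← map_pow, ← hu, map_mul, map_mul]
  field_simp

lemma exists_le_range_mulZPow (V : Submodule k K) [FiniteDimensional k V] :
    ∃ i : ℤ, V ≤ LinearMap.range (mulZPow k K ϖ i) := by
  obtain ⟨s, rfl⟩ := Module.Finite.iff_fg.mp (inferInstance : Module.Finite k V)
  choose ord hord using exists_mem_range_mulZPow hϖ (k := k) (K := K)
  obtain ⟨a, ha⟩ := (s.image ord).bddBelow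
  exact ⟨a, Submodule.span_le.mpr fun z hz =>
    antitone_range_mulZPow hϖ.ne_zero (ha (Finset.mem_image_of_mem ord hz)) (hord z)⟩

lemma exists_comap_mulZPow_eq_bot (V : Submodule k K) [FiniteDimensional k V] (a : ℤ) :
    ∃ n : ℕ, V.comap (mulZPow k K ϖ (a + n)) = ⊥ := by
  let f : ℕ →o (Submodule k V)ᵒᵈ :=
    ⟨fun n => .toDual ((LinearMap.range (mulZPow k K ϖ (a + n))).comap V.subtype), fun m n h =>
      OrderDual.toDual_le_toDual.mpr
        (Submodule.comap_mono (antitone_range_mulZPow hϖ.ne_zero (K := K) (by gcongr)))⟩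
  obtain ⟨n, hn⟩ := IsArtinian.monotone_stabilizes f
  refine ⟨n, (Submodule.eq_bot_iff _).mpr fun z hz => ?_⟩
  by_contra hz0
  obtain ⟨m, hm⟩ := FiniteMultiplicity.of_not_isUnit hϖ.not_isUnit hz0
  have stable := OrderDual.toDual.injective (hn (n + (m + 1)) (by omega))
  obtain ⟨w, hw⟩ : mulZPow k K ϖ (a + n) z ∈
      LinearMap.range (mulZPow k K ϖ (a + (n + (m + 1) : ℕ))) :=
    (Submodule.ext_iff.mp stable ⟨_, hz⟩).mp ⟨z, rfl⟩
  rw [Nat.cast_add, ← add_assoc, ← mulZPow_mul_pow hϖ.ne_zero] at hw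
  exact hm (Dvd.intro_left w (mulZPow_injective hϖ.ne_zero _ hw))

lemma exists_finrank_eq_sum_leadingCoeffs (V : Submodule k K) [FiniteDimensional k V] :
    ∃ (a : ℤ) (n : ℕ), Module.finrank k V =
      ∑ i ∈ Finset.Ico a (a + n), Module.finrank k (leadingCoeffs ϖ i V) := by
  obtain ⟨a, ha⟩ := exists_le_range_mulZPow hϖ V
  obtain ⟨n, hn⟩ := exists_comap_mulZPow_eq_bot hϖ V a
  have comap_equiv := Submodule.equivMapOfInjective _
    (mulZPow_injective (k := k) (K := K) hϖ.ne_zero a) (V.comap (mulZPow k K ϖ a))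
  have sum_eq := sum_finrank_leadingCoeffs_add hϖ V a n
  rw [hn, finrank_bot, add_zero, comap_equiv.finrank_eq, Submodule.map_comap_eq_of_le ha] at sum_eq
  exact ⟨a, n, sum_eq.symm⟩

omit hϖ

-- Since `E` lifts to `E'` both in order `0` and in order `1`, a pair `(i, j)` of orders contributes
-- to `E' V W` in the two orders `i + j` and `i + j + 1` required by the one-variable inequality.
theorem HasLinearBrunnMinkowski.of_residueField {d : ℕ}
    (hκ : HasLinearBrunnMinkowski d k (ResidueField O)) : HasLinearBrunnMinkowski (d + 1) k K := by
  obtain ⟨ϖ, hϖ⟩ := IsDiscreteValuationRing.exists_irreducible O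
  obtain ⟨E, hE, hκ⟩ := hκ
  obtain ⟨E', hE', hEE'⟩ := exists_le_leadingCoeffs_zero_one (K := K) ϖ E
  refine ⟨E', hE', fun V W _ _ hV hW => ?_⟩
  obtain ⟨a, n, hVsum⟩ := exists_finrank_eq_sum_leadingCoeffs hϖ V
  obtain ⟨b, m, hWsum⟩ := exists_finrank_eq_sum_leadingCoeffs hϖ W
  have exists_pos {V : Submodule k K} [FiniteDimensional k V] (hV : V ≠ ⊥) {s : Finset ℤ}
      (hs : Module.finrank k V = ∑ i ∈ s, Module.finrank k (leadingCoeffs ϖ i V)) :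
      ∃ i ∈ s, (0 : ℝ) < Module.finrank k (leadingCoeffs ϖ i V) := by
    obtain ⟨i, hi, hpos⟩ := Finset.sum_pos_iff.mp (hs ▸ Nat.pos_of_ne_zero
      (Submodule.finrank_eq_zero.not.mpr hV))
    exact ⟨i, hi, Nat.cast_pos.mpr hpos⟩
  have ne_bot {i : ℤ} {V : Submodule k K}
      (hi : (0 : ℝ) < Module.finrank k (leadingCoeffs ϖ i V)) : leadingCoeffs ϖ i V ≠ ⊥ :=
    fun h => by rw [h, finrank_bot, Nat.cast_zero] at hi; exact hi.false
  have finite := finiteDimensional_leadingCoeffs hϖ.ne_zero (k := k) (K := K)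
  refine le_trans ?_ (Nat.cast_le.mpr (sum_finrank_leadingCoeffs_le hϖ _ (a + b) (n + m + 1)))
  rw [hVsum, hWsum]
  push_cast
  refine brunnMinkowskiSum_succ_sum_le d (fun _ => by positivity) (fun _ => by positivity)
    (fun _ => by positivity) (exists_pos hV hVsum) (exists_pos hW hWsum)
    fun i hi j hj hi0 hj0 l hl => ?_
  obtain ⟨ε, hε, rfl⟩ : ∃ ε : ℤ, (ε = 0 ∨ ε = 1) ∧ l = ε + i + j :=
    ⟨l - i - j, by simp only [Finset.mem_insert, Finset.mem_singleton] at hl; omega, by ring⟩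
  have leading_product : E * leadingCoeffs ϖ i V * leadingCoeffs ϖ j W ≤
      leadingCoeffs ϖ (ε + i + j) (E' * V * W) :=
    (mul_le_mul_left ((mul_le_mul_left (hEE' ε hε) _).trans
      (leadingCoeffs_mul_le hϖ.ne_zero ε i _ V)) _).trans
      (leadingCoeffs_mul_le hϖ.ne_zero _ j _ W)
  refine ⟨by simp only [Finset.mem_Ico] at hi hj ⊢; omega,
    (hκ _ _ (finite i V) (finite j W) (ne_bot hi0) (ne_bot hj0)).trans ?_⟩
  have := finite (ε + i + j) (E' * V * W)
  exact mod_cast Submodule.finrank_mono leading_product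

end LeadingCoefficients

/-! ### Discrete valuations of finitely generated field extensions -/

section DiscreteValuations

open Polynomial

section PolynomialRelations

variable {F B : Type*} [Field F] [CommRing B] [Algebra F B] {x : B}

lemma aeval_eq_mul_aeval_divX_add (x : B) (p : F[X]) :
    aeval x p = x * aeval x p.divX + algebraMap F B (p.coeff 0) := by
  conv_lhs => rw [← divX_mul_X_add p]
  simp only [map_add, map_mul, aeval_X, aeval_C, mul_comm]

lemma eq_zero_of_sum_aeval_mul_eq_zero (hx : x ∈ nonZeroDivisors B) {ι : Type*} {b : ι → B}
    (hb : LinearIndependent F fun i => Ideal.Quotient.mk (Ideal.span {x}) (b i)) {s : Finset ι}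
    {p : ι → F[X]} (hp : ∑ i ∈ s, aeval x (p i) * b i = 0) {i : ι} (hi : i ∈ s) : p i = 0 := by
  suffices ∀ (n : ℕ) (p : ι → F[X]), ∑ i ∈ s, aeval x (p i) * b i = 0 → (p i).coeff n = 0 from
    Polynomial.ext fun n => this n p hp
  have sum_eq (p : ι → F[X]) : ∑ i ∈ s, aeval x (p i) * b i =
      x * ∑ i ∈ s, aeval x (p i).divX * b i + ∑ i ∈ s, (p i).coeff 0 • b i := by
    rw [Finset.mul_sum, ← Finset.sum_add_distrib]
    refine Finset.sum_congr rfl fun i _ => ?_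
    rw [aeval_eq_mul_aeval_divX_add, Algebra.smul_def]
    ring
  have coeff_zero (p : ι → F[X]) (hp : ∑ i ∈ s, aeval x (p i) * b i = 0) :
      ∀ i ∈ s, (p i).coeff 0 = 0 := by
    refine linearIndependent_iff'.mp hb s _ ?_
    have mod_x := congrArg (Ideal.Quotient.mkₐ F (Ideal.span {x})) ((sum_eq p).symm.trans hp)
    have mk_x : Ideal.Quotient.mkₐ F (Ideal.span {x}) x = 0 :=
      Ideal.Quotient.eq_zero_iff_mem.mpr (Ideal.mem_span_singleton_self x)
    simp only [map_add, map_mul, mk_x, zero_mul, zero_add, map_sum, map_smul, map_zero] at mod_x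
    exact mod_x
  intro n
  induction n with
  | zero => exact fun p hp => coeff_zero p hp i hi
  | succ n ih =>
    intro p hp
    rw [← coeff_divX]
    refine ih (fun i => (p i).divX) ((mul_right_mem_nonZeroDivisors_eq_zero_iff hx).mp ?_)
    have constants_vanish : ∑ i ∈ s, (p i).coeff 0 • b i = 0 :=
      Finset.sum_eq_zero fun i hi => by rw [coeff_zero p hp i hi, zero_smul]
    rw [mul_comm, ← hp, sum_eq p, constants_vanish, add_zero]

end PolynomialRelations

section LocalDomain

variable {F B : Type*} [Field F] [CommRing B] [IsLocalRing B] [Algebra F B] {x : B}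

lemma isUnit_aeval_of_coeff_zero_ne_zero (hx : x ∈ IsLocalRing.maximalIdeal B) {q : F[X]}
    (hq : q.coeff 0 ≠ 0) : IsUnit (aeval x q) := by
  by_contra hnonunit
  have coeff_mem := sub_mem ((IsLocalRing.mem_maximalIdeal _).mpr hnonunit)
    (Ideal.mul_mem_right (aeval x q.divX) _ hx)
  rw [aeval_eq_mul_aeval_divX_add, add_sub_cancel_left] at coeff_mem
  exact (IsLocalRing.mem_maximalIdeal _).mp coeff_mem (hq.isUnit.map (algebraMap F B))

lemma exists_aeval_dvd_pow (hx : x ∈ IsLocalRing.maximalIdeal B) {p : F[X]} (hp : p ≠ 0) :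
    ∃ n, aeval x p ∣ x ^ n := by
  obtain ⟨q, hpq, hq⟩ :=
    (FiniteMultiplicity.of_prime_left prime_X hp).exists_eq_pow_mul_and_not_dvd
  rw [X_dvd_iff] at hq
  refine ⟨multiplicity X p, ?_⟩
  nth_rewrite 1 [hpq]
  rw [map_mul, map_pow, aeval_X]
  exact (isUnit_aeval_of_coeff_zero_ne_zero hx hq).mul_right_dvd.mpr dvd_rfl

end LocalDomain

-- By Cohen's theorem it suffices that a nonzero prime is finitely generated. It contains `x`, and
-- modulo `x` it is finitely generated.
lemma isNoetherianRing_of_forall_dvd_pow {B : Type*} [CommRing B] {x : B}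
    [IsNoetherianRing (B ⧸ Ideal.span {x})] (hx : ∀ b : B, b ≠ 0 → ∃ n, b ∣ x ^ n) :
    IsNoetherianRing B := by
  refine .of_prime_ne_bot fun P hP hP0 => ?_
  obtain ⟨b, hbP, hb⟩ := P.ne_bot_iff.mp hP0
  obtain ⟨n, hn⟩ := hx b hb
  have hxP : Ideal.span {x} ≤ P :=
    (Ideal.span_singleton_le_iff_mem P).mpr (hP.mem_of_pow_mem n (P.mem_of_dvd hn hbP))
  refine Ideal.fg_of_fg_map_of_fg_inf_ker_of_surjective (f := Ideal.Quotient.mk (Ideal.span {x}))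
    (IsNoetherian.noetherian _) ?_ Ideal.Quotient.mk_surjective
  rw [Ideal.mk_ker, inf_eq_right.mpr hxP]
  exact Submodule.fg_span_singleton x

section Subalgebras

open scoped IntermediateField.algebraAdjoinAdjoin

variable {F K : Type*} [Field F] [Field K] [Algebra F K] {B : Subalgebra F K} {x : B}

lemma finiteDimensional_quotient_span_singleton (hx : x ≠ 0)
    [FiniteDimensional (IntermediateField.adjoin F {(x : K)}) K] :
    FiniteDimensional F (B ⧸ Ideal.span {x}) := by
  have : Module.Free F (B ⧸ Ideal.span {x}) := .of_divisionRing F _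
  refine Module.rank_lt_aleph0_iff.mp (lt_of_le_of_lt (rank_le fun s hs => ?_)
    (Cardinal.natCast_lt_aleph0 (n := Module.finrank (IntermediateField.adjoin F {(x : K)}) K)))
  choose lift hlift using Ideal.Quotient.mk_surjective (I := Ideal.span {x})
  suffices LinearIndependent (Algebra.adjoin F {(x : K)}) fun i : s => (lift i : K) by
    exact (Fintype.card_coe s).symm.trans_le ((LinearIndependent.iff_fractionRing _
      (IntermediateField.adjoin F {(x : K)})).mp this).fintype_card_le_finrank
  refine linearIndependent_iff'.mpr fun t g hg i hi => ?_
  have exists_aeval (a : Algebra.adjoin F {(x : K)}) : ∃ p : F[X], aeval (x : K) p = a :=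
    (Algebra.adjoin_singleton_eq_range_aeval F (x : K) ▸ a.2 : _ ∈ (aeval (x : K)).range)
  choose p hp using exists_aeval
  have relation : ∑ i ∈ t, aeval x (p (g i)) * lift i = 0 := by
    refine Subtype.ext ?_
    simpa [aeval_subalgebra_coe, hp, Algebra.smul_def, Subalgebra.algebraMap_def] using hg
  have p_eq_zero := eq_zero_of_sum_aeval_mul_eq_zero (mem_nonZeroDivisors_of_ne_zero hx)
    (by simpa only [hlift] using hs) relation hi
  exact Subtype.ext (by rw [← hp, p_eq_zero, map_zero, ZeroMemClass.coe_zero])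

lemma exists_dvd_pow_of_isAlgebraic [IsLocalRing B] (hx : x ∈ IsLocalRing.maximalIdeal B)
    [Algebra.IsAlgebraic (IntermediateField.adjoin F {(x : K)}) K] {b : B} (hb : b ≠ 0) :
    ∃ n, b ∣ x ^ n := by
  have adjoin_le : Algebra.adjoin F {(x : K)} ≤ B :=
    Algebra.adjoin_le (Set.singleton_subset_iff.mpr x.2)
  let := (Subalgebra.inclusion adjoin_le).toAlgebra
  have : IsScalarTower (Algebra.adjoin F {(x : K)}) B K := .of_algebraMap_eq fun _ => rfl
  have : Algebra.IsAlgebraic (Algebra.adjoin F {(x : K)}) K :=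
    (IsFractionRing.comap_isAlgebraic_iff (K := IntermediateField.adjoin F {(x : K)})).mpr
      inferInstance
  have b_algebraic : IsAlgebraic (Algebra.adjoin F {(x : K)}) b :=
    (isAlgebraic_algebraMap_iff Subtype.val_injective).mp (Algebra.IsAlgebraic.isAlgebraic (b : K))
  obtain ⟨⟨a, ha⟩, ha0, hba⟩ := b_algebraic.exists_nonzero_dvd (mem_nonZeroDivisors_of_ne_zero hb)
  obtain ⟨p, rfl⟩ : ∃ p : F[X], aeval (x : K) p = a :=
    (Algebra.adjoin_singleton_eq_range_aeval F (x : K) ▸ ha : _ ∈ (aeval (x : K)).range)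
  obtain ⟨n, hn⟩ := exists_aeval_dvd_pow hx (p := p) fun hp => ha0 (Subtype.ext (by simp [hp]))
  refine ⟨n, hba.trans ((dvd_of_eq (Subtype.ext ?_)).trans hn)⟩
  exact aeval_algebraMap_apply K x p

lemma exists_valuationRing_mem_maximalIdeal {x : K} (hx : Transcendental F x) :
    ∃ (B : Subalgebra F K) (_ : ValuationRing B) (_ : IsFractionRing B K) (x' : B),
      (x' : K) = x ∧ x' ∈ IsLocalRing.maximalIdeal B := by
  let A := Algebra.adjoin F {x}
  let x' : A.toSubring := ⟨x, Algebra.subset_adjoin rfl⟩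
  have x_nonunit : Ideal.span {x'} ≠ ⊤ := by
    rw [Ne, Ideal.span_singleton_eq_top]
    intro hu
    obtain ⟨⟨a, ha⟩, hxa⟩ := hu.exists_right_inv
    obtain ⟨p, rfl⟩ := (Algebra.adjoin_singleton_eq_range_aeval F x ▸ ha :
      a ∈ (aeval x : F[X] →ₐ[F] K).range)
    have relation : aeval x (X * p - 1) = 0 := by
      simpa [sub_eq_zero] using congrArg Subtype.val hxa
    simpa using congrArg (eval 0) (transcendental_iff.mp hx _ relation)
  obtain ⟨V, hAV, hxV⟩ := Ideal.image_subset_nonunits_valuationSubring _ x_nonunit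
  let B : Subalgebra F K :=
    { V.toSubring with algebraMap_mem' := fun c => hAV (A.algebraMap_mem c) }
  refine ⟨B, inferInstanceAs (ValuationRing V), inferInstanceAs (IsFractionRing V K),
    ⟨x, hAV x'.2⟩, rfl, ?_⟩
  obtain ⟨_, hx_nonunit⟩ := V.mem_nonunits_iff_exists_mem_maximalIdeal.mp
    (hxV ⟨x', Ideal.subset_span rfl, rfl⟩)
  exact hx_nonunit

theorem exists_discreteValuationSubalgebra {x : K} (hx : Transcendental F x)
    [FiniteDimensional (IntermediateField.adjoin F {x}) K] :
    ∃ (B : Subalgebra F K) (_ : IsDiscreteValuationRing B), IsFractionRing B K ∧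
      FiniteDimensional F (IsLocalRing.ResidueField B) := by
  obtain ⟨B, _, hB, x, rfl, hxB⟩ := exists_valuationRing_mem_maximalIdeal hx
  have hx0 : x ≠ 0 := by
    rintro rfl
    exact hx isAlgebraic_zero
  have finite_quotient := finiteDimensional_quotient_span_singleton hx0
  have : IsNoetherianRing (B ⧸ Ideal.span {x}) := isNoetherian_of_tower F inferInstance
  have : IsNoetherianRing B :=
    isNoetherianRing_of_forall_dvd_pow fun b hb => exists_dvd_pow_of_isAlgebraic hxB hb
  have : IsPrincipalIdealRing B := (IsBezout.TFAE.out 0 1).mp this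
  refine ⟨B, { not_a_field' := fun h => hx0 (by simpa [h] using hxB) }, hB, ?_⟩
  have span_le := (Ideal.span_singleton_le_iff_mem (IsLocalRing.maximalIdeal B)).mpr hxB
  exact Module.Finite.of_surjective (Ideal.Quotient.factorₐ F span_le).toLinearMap
    (Ideal.Quotient.factor_surjective span_le)

end Subalgebras

end DiscreteValuations

section TranscendenceDegree

open IntermediateField

variable {k K : Type*} [Field k] [Field K] [Algebra k K]

open scoped algebraAdjoinAdjoin in
lemma trdeg_adjoin {s : Set K} (hs : AlgebraicIndependent k ((↑) : s → K)) :
    Algebra.trdeg k (adjoin k s) = Cardinal.mk s := by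
  have algebraic : Algebra.IsAlgebraic (Algebra.adjoin k s) (adjoin k s) :=
    (IsFractionRing.comap_isAlgebraic_iff (K := adjoin k s)).mpr inferInstance
  have lift_trdeg_algebraAdjoin := hs.aevalEquiv.lift_trdeg_eq
  rw [Subtype.range_coe] at lift_trdeg_algebraAdjoin
  rw [← trdeg_add_eq k (Algebra.adjoin k s), trdeg_eq_zero_iff.mpr algebraic, add_zero]
  simpa [MvPolynomial.trdeg_of_isDomain] using lift_trdeg_algebraAdjoin.symm

lemma exists_intermediateField_trdeg_eq {m : ℕ} (h : m ≤ Algebra.trdeg k K) :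
    ∃ F : IntermediateField k K, Algebra.EssFiniteType k F ∧ Algebra.trdeg k F = m := by
  obtain ⟨b, hb⟩ := exists_isTranscendenceBasis k K
  obtain ⟨s, hsb, hs⟩ := Cardinal.le_mk_iff_exists_subset.mp (hb.cardinalMk_eq_trdeg ▸ h)
  have : s.Finite := Cardinal.lt_aleph0_iff_set_finite.mp (hs ▸ Cardinal.natCast_lt_aleph0)
  exact ⟨adjoin k s, essFiniteType_iff.mpr (fg_adjoin_of_finite this),
    (trdeg_adjoin (hb.1.mono hsb)).trans hs⟩

lemma exists_transcendental_isAlgebraic_adjoin (h : Algebra.trdeg k K = 1) :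
    ∃ x : K, Transcendental k x ∧ Algebra.IsAlgebraic k⟮x⟯ K := by
  obtain ⟨s, hs⟩ := exists_isTranscendenceBasis k K
  obtain ⟨x, rfl⟩ := Cardinal.mk_set_eq_one_iff.mp (hs.cardinalMk_eq_trdeg.trans h)
  have algebraic := hs.isAlgebraic_field
  rw [Subtype.range_coe] at algebraic
  exact ⟨x, algebraicIndependent_unique_type_iff.mp hs.1, algebraic⟩

open scoped algebraAdjoinAdjoin in
lemma linearIndependent_adjoin_of_algebraicIndependent {F L : Type*} [Field F] [Field L]
    [Algebra F L] [Algebra F K] [Algebra L K] [IsScalarTower F L K] {σ ι : Type*} {z : σ → K}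
    (hz : AlgebraicIndependent L z) [Finite ι] {w : ι → L} (hw : LinearIndependent F w) :
    LinearIndependent (adjoin F (Set.range z)) fun i => algebraMap L K (w i) := by
  have := Fintype.ofFinite ι
  rw [← LinearIndependent.iff_fractionRing (Algebra.adjoin F (Set.range z)),
    Fintype.linearIndependent_iff]
  intro c hc i
  have exists_aeval (i : ι) : ∃ p : MvPolynomial σ F, MvPolynomial.aeval z p = (c i : K) :=
    (Algebra.adjoin_range_eq_range_aeval F z).le (c i).2
  choose p hp using exists_aeval
  have relation : ∑ i, MvPolynomial.C (w i) * MvPolynomial.map (algebraMap F L) (p i) = 0 := by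
    apply hz
    simpa [MvPolynomial.aeval_map_algebraMap, hp, Algebra.smul_def, mul_comm] using hc
  have p_eq_zero : p i = 0 := by
    ext d
    have coeff_relation := congrArg (MvPolynomial.coeff d) relation
    simp only [MvPolynomial.coeff_sum, MvPolynomial.coeff_C_mul, MvPolynomial.coeff_map,
      MvPolynomial.coeff_zero] at coeff_relation
    exact Fintype.linearIndependent_iff.mp hw (fun i => (p i).coeff d)
      (by simpa only [Algebra.smul_def, mul_comm] using coeff_relation) i
  exact Subtype.ext (by rw [← hp, p_eq_zero, map_zero, ZeroMemClass.coe_zero])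

lemma finiteDimensional_of_finiteDimensional_adjoin {F L : Type*} [Field F] [Field L]
    [Algebra F L] [Algebra F K] [Algebra L K] [IsScalarTower F L K] {σ : Type*} {z : σ → K}
    (hz : AlgebraicIndependent L z) [FiniteDimensional (adjoin F (Set.range z)) K] :
    FiniteDimensional F L :=
  Module.rank_lt_aleph0_iff.mp <| (rank_le fun s hs => by
    simpa using (linearIndependent_adjoin_of_algebraicIndependent hz hs).fintype_card_le_finrank
    ).trans_lt Cardinal.natCast_lt_aleph0

-- Let `L` be algebraic over a finitely generated `F`. Adjoining to `F` a transcendence basis of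
-- `K / L` gives a field over which `K` is finite; as that basis is independent over `L`, already
-- `L` is finite over `F`.
lemma essFiniteType_intermediateField [Algebra.EssFiniteType k K] (L : IntermediateField k K) :
    Algebra.EssFiniteType k L := by
  obtain ⟨F, hF, _⟩ := (finTrdeg_iff_trdeg.mpr ((self_le_add_right _ _).trans_lt
    ((trdeg_add_eq k L (A := K)).trans_lt (trdeg_lt_aleph0 k K)))).exists_fg_isAlgebraic
  have : Algebra.EssFiniteType k F := essFiniteType_iff.mpr hF
  obtain ⟨t, ht⟩ := exists_isTranscendenceBasis L K
  let M := adjoin F (Set.range ((↑) : t → K))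
  have : Algebra.EssFiniteType F K := .of_comp k F K
  have : Algebra.EssFiniteType M K := .of_comp F M K
  have : Algebra.IsAlgebraic M K :=
    ((Algebra.IsAlgebraic.isTranscendenceBasis_iff F L).mpr ht).isAlgebraic_field
  have : FiniteDimensional M K := Algebra.finite_of_essFiniteType_of_isAlgebraic
  have : FiniteDimensional F L := finiteDimensional_of_finiteDimensional_adjoin ht.1
  exact .comp k F L

end TranscendenceDegree

section LinearBrunnMinkowski

lemma hasLinearBrunnMinkowski_zero (k K : Type*) [Field k] [Field K] [Algebra k K]
    [FiniteDimensional k K] : HasLinearBrunnMinkowski 0 k K := by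
  refine ⟨⊤, inferInstance, fun V W _ _ hV hW => ?_⟩
  obtain ⟨v, hvV, hv⟩ := V.ne_bot_iff.mp hV
  obtain ⟨w, hwW, hw⟩ := W.ne_bot_iff.mp hW
  have mul_eq_top : ⊤ * V * W = ⊤ := eq_top_iff.mpr fun z _ => by
    have hz : z = z / (v * w) * v * w := by field_simp
    rw [hz]
    exact Submodule.mul_mem_mul (Submodule.mul_mem_mul trivial hvV) hwW
  rw [mul_eq_top, finrank_top]
  exact max_le (mod_cast Submodule.finrank_le V) (mod_cast Submodule.finrank_le W)

open IntermediateField in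
theorem hasLinearBrunnMinkowski_of_trdeg_eq {k : Type*} {K : Type u} [Field k] [Field K]
    [Algebra k K] [Algebra.EssFiniteType k K] {t : ℕ} (ht : Algebra.trdeg k K = t) :
    HasLinearBrunnMinkowski t k K := by
  induction t generalizing K with
  | zero =>
    have : Algebra.IsAlgebraic k K := trdeg_eq_zero_iff.mp (mod_cast ht)
    have : FiniteDimensional k K := Algebra.finite_of_essFiniteType_of_isAlgebraic
    exact hasLinearBrunnMinkowski_zero k K
  | succ t ih =>
    obtain ⟨F, _, hF⟩ := exists_intermediateField_trdeg_eq (k := k) (K := K) (m := t)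
      (ht ▸ mod_cast t.le_succ)
    have trdeg_F_K : Algebra.trdeg F K = 1 := by
      have trdeg_add := trdeg_add_eq k F (A := K)
      rw [hF, ht, Nat.cast_succ, add_comm, add_comm _ 1] at trdeg_add
      exact (Cardinal.add_right_inj_of_lt_aleph0 Cardinal.natCast_lt_aleph0).mp trdeg_add
    obtain ⟨x, hx, _⟩ := exists_transcendental_isAlgebraic_adjoin trdeg_F_K
    have : Algebra.EssFiniteType F K := .of_comp k F K
    have : Algebra.EssFiniteType F⟮x⟯ K := .of_comp F F⟮x⟯ K
    have : FiniteDimensional F⟮x⟯ K := Algebra.finite_of_essFiniteType_of_isAlgebraic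
    obtain ⟨B, _, _, _⟩ := exists_discreteValuationSubalgebra hx
    have : Algebra.EssFiniteType k (IsLocalRing.ResidueField B) := .comp k F _
    have : FaithfulSMul F (IsLocalRing.ResidueField B) :=
      (faithfulSMul_iff_algebraMap_injective _ _).mpr (algebraMap F _).injective
    refine (ih ?_).of_residueField (O := B)
    rw [← trdeg_add_eq k F, hF, trdeg_eq_zero, add_zero]

end LinearBrunnMinkowski

/-! ### Saturated powers -/

section SaturatedPowers

variable {k K : Type*} [Field k] [CommRing K] [Algebra k K] {Y : Submodule k K}

/-- The elements `f` with `f * Y ^ M ≤ Y ^ (a + M)` for some, equivalently for every large, `M`.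
If `Y` is spanned by the coordinates of a projective variety, this is the space of rational
functions that are locally forms of degree `a` in these coordinates. -/
def saturatedPow (Y : Submodule k K) (a : ℕ) : Submodule k K :=
  ⨆ M : ℕ, Y ^ (a + M) / Y ^ M

lemma monotone_pow_add_div_pow (Y : Submodule k K) (a : ℕ) :
    Monotone fun M : ℕ => Y ^ (a + M) / Y ^ M :=
  monotone_nat_of_le_succ fun M => Submodule.le_div_iff_mul_le.mpr <| by
    rw [pow_succ, ← mul_assoc, ← add_assoc, pow_succ]
    exact mul_le_mul_left (Submodule.le_div_iff_mul_le.mp le_rfl) Y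

lemma mem_saturatedPow {a : ℕ} {f : K} :
    f ∈ saturatedPow Y a ↔ ∃ M, f ∈ Y ^ (a + M) / Y ^ M :=
  Submodule.mem_iSup_of_directed _ (monotone_pow_add_div_pow Y a).directed_le

instance gradedMonoid_saturatedPow (Y : Submodule k K) : SetLike.GradedMonoid (saturatedPow Y) where
  one_mem := mem_saturatedPow.mpr ⟨0, Submodule.mem_div_iff_forall_mul_mem.mpr fun g hg => by
    rwa [one_mul]⟩
  mul_mem a b f g hf hg := by
    obtain ⟨M, hM⟩ := mem_saturatedPow.mp hf
    obtain ⟨N, hN⟩ := mem_saturatedPow.mp hg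
    replace hM := monotone_pow_add_div_pow Y a (M.le_add_left (b + N)) hM
    rw [Submodule.mem_div_iff_forall_mul_mem] at hM
    refine mem_saturatedPow.mpr ⟨N + M, Submodule.mem_div_iff_forall_mul_mem.mpr fun e he => ?_⟩
    replace hN := monotone_pow_add_div_pow Y b (N.le_add_right M) hN
    rw [mul_assoc, add_assoc, ← add_assoc b]
    exact hM _ (by simpa only [add_assoc] using Submodule.mem_div_iff_forall_mul_mem.mp hN e he)

lemma pow_le_saturatedPow (a : ℕ) : Y ^ a ≤ saturatedPow Y a := fun _ hf =>
  mem_saturatedPow.mpr ⟨0, Submodule.mem_div_iff_forall_mul_mem.mpr fun g hg => by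
    rw [pow_add]
    exact Submodule.mul_mem_mul hf hg⟩

lemma exists_mul_pow_le_of_le_saturatedPow {a : ℕ} (V : Submodule k K) [FiniteDimensional k V]
    (hV : V ≤ saturatedPow Y a) : ∃ M, V * Y ^ M ≤ Y ^ (a + M) := by
  have compact := (Submodule.fg_iff_compact V).mp (Module.Finite.iff_fg.mp inferInstance)
  obtain ⟨_, ⟨M, rfl⟩, hM⟩ := compact _ _ (Set.range_nonempty _)
    (monotone_pow_add_div_pow Y a).directed_le.directedOn_range isLUB_iSup hV
  exact ⟨M, Submodule.le_div_iff_mul_le.mp hM⟩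

open scoped Pointwise in
lemma exists_eq_pow_mul_of_mem_pow {ι : Type*} [Fintype ι] {y : ι → K} {M : ι → ℕ} {n : ℕ}
    (hn : ∑ i, M i < n) {z : K} (hz : z ∈ Set.range y ^ n) :
    ∃ i, M i ≤ n ∧ ∃ g ∈ Submodule.span k (Set.range y) ^ (n - M i), z = y i ^ M i * g := by
  classical
  obtain ⟨g, hg, rfl⟩ := Set.mem_pow_iff_prod.mp hz
  choose σ hσ using hg
  obtain ⟨i, hi⟩ : ∃ i, M i ≤ (Finset.univ.filter fun j => σ j = i).card := by
    by_contra! h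
    have := Finset.sum_le_sum (s := Finset.univ) fun i _ => (h i).le
    rw [← Finset.card_eq_sum_card_fiberwise fun j _ => Finset.mem_univ (σ j), Finset.card_univ,
      Fintype.card_fin] at this
    omega
  obtain ⟨T, hT, card_T⟩ := Finset.exists_subset_card_eq hi
  refine ⟨i, (Finset.single_le_sum_of_canonicallyOrdered (Finset.mem_univ i)).trans hn.le,
    ∏ j ∈ Tᶜ, g j, ?_, ?_⟩
  · have := SetLike.prod_mem_graded (fun n => Submodule.span k (Set.range y) ^ n) (fun _ => 1) g
      (F := Tᶜ) fun j _ => by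
        rw [pow_one, ← hσ]
        exact Submodule.subset_span ⟨_, rfl⟩
    simpa [Finset.card_compl, card_T] using this
  · rw [← Finset.prod_mul_prod_compl T, ← card_T]
    congr 1
    exact Finset.prod_eq_pow_card fun j hj => by rw [← hσ, (Finset.mem_filter.mp (hT hj)).2]

lemma mem_saturatedPow_of_forall {ι : Type*} [Finite ι] {y : ι → K} {a : ℕ} {f : K}
    (hf : ∀ i, ∃ M, f * y i ^ M ∈ Submodule.span k (Set.range y) ^ (a + M)) :
    f ∈ saturatedPow (Submodule.span k (Set.range y)) a := by
  have := Fintype.ofFinite ι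
  choose M hM using hf
  set Y := Submodule.span k (Set.range y) with hY
  let n := ∑ i, M i + 1
  refine mem_saturatedPow.mpr ⟨n, Submodule.mem_div_iff_forall_mul_mem.mpr ?_⟩
  change Y ^ n ≤ (Y ^ (a + n)).comap (LinearMap.mulLeft k f)
  rw [hY, Submodule.span_pow, Submodule.span_le, ← hY]
  intro z hz
  have sum_lt : ∑ i, M i < n := Nat.lt_succ_self _
  obtain ⟨i, hi, g, hg, rfl⟩ := exists_eq_pow_mul_of_mem_pow (k := k) sum_lt hz
  rw [SetLike.mem_coe, Submodule.mem_comap, LinearMap.mulLeft_apply, ← mul_assoc,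
    ← Nat.add_sub_of_le hi, ← add_assoc, pow_add]
  exact Submodule.mul_mem_mul (hM i) hg

end SaturatedPowers

section RatioField

variable {k K : Type*} [Field k] [Field K] [Algebra k K]

/-- The field of ratios of elements of the same degree of a graded algebra `⨁ a, L a` inside
`K[T]`; for the sections of the multiples of a divisor it is the function field of the closure of
the image of the associated rational map. -/
def ratioField (L : ℕ → Submodule k K) [SetLike.GradedMonoid L] : IntermediateField k K where
  carrier := {z | ∃ a, ∃ f ∈ L a, ∃ g ∈ L a, g ≠ 0 ∧ z = f / g}
  mul_mem' := by
    rintro _ _ ⟨a, f, hf, g, hg, hg0, rfl⟩ ⟨a', f', hf', g', hg', hg0', rfl⟩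
    exact ⟨a + a', f * f', SetLike.mul_mem_graded hf hf', g * g', SetLike.mul_mem_graded hg hg',
      mul_ne_zero hg0 hg0', div_mul_div_comm _ _ _ _⟩
  add_mem' := by
    rintro _ _ ⟨a, f, hf, g, hg, hg0, rfl⟩ ⟨a', f', hf', g', hg', hg0', rfl⟩
    exact ⟨a + a', f * g' + g * f',
      add_mem (SetLike.mul_mem_graded hf hg') (SetLike.mul_mem_graded hg hf'), g * g',
      SetLike.mul_mem_graded hg hg', mul_ne_zero hg0 hg0', div_add_div _ _ hg0 hg0'⟩
  algebraMap_mem' c := ⟨0, algebraMap k K c, by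
    rw [Algebra.algebraMap_eq_smul_one]
    exact Submodule.smul_mem _ _ SetLike.GradedOne.one_mem, 1, SetLike.GradedOne.one_mem,
    one_ne_zero, (div_one _).symm⟩
  inv_mem' := by
    rintro _ ⟨a, f, hf, g, hg, hg0, rfl⟩
    obtain rfl | hf0 := eq_or_ne f 0
    · exact ⟨a, 0, zero_mem _, g, hg, hg0, by simp⟩
    · exact ⟨a, g, hg, f, hf, hf0, inv_div _ _⟩

variable {L : ℕ → Submodule k K} [SetLike.GradedMonoid L]

lemma div_mem_ratioField {a : ℕ} {f g : K} (hf : f ∈ L a) (hg : g ∈ L a) :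
    f / g ∈ ratioField L := by
  obtain rfl | hg0 := eq_or_ne g 0
  · rw [div_zero]
    exact zero_mem _
  · exact ⟨a, f, hf, g, hg, hg0, rfl⟩

lemma exists_common_denominator {V : Submodule k K} (hV : V.FG) (h : ∀ v ∈ V, v ∈ ratioField L) :
    ∃ a, ∃ g ∈ L a, g ≠ 0 ∧ Submodule.span k {g} * V ≤ L a := by
  induction V, hV using Submodule.fg_induction with
  | singleton v =>
    obtain ⟨a, f, hf, g, hg, hg0, rfl⟩ := h v (Submodule.mem_span_singleton_self v)
    refine ⟨a, g, hg, hg0, ?_⟩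
    rw [Submodule.span_mul_span, Set.singleton_mul_singleton, mul_div_cancel₀ _ hg0]
    exact (Submodule.span_singleton_le_iff_mem _ _).mpr hf
  | sup V W _ _ ihV ihW =>
    obtain ⟨a, g, hg, hg0, hgV⟩ := ihV fun v hv => h v (le_sup_left (a := V) hv)
    obtain ⟨b, e, he, he0, heW⟩ := ihW fun v hv => h v (le_sup_right (a := V) hv)
    refine ⟨a + b, g * e, SetLike.mul_mem_graded hg he, mul_ne_zero hg0 he0, ?_⟩
    have mul_le : L a * L b ≤ L (a + b) :=
      Submodule.mul_le.mpr fun _ hx _ hy => SetLike.mul_mem_graded hx hy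
    rw [← Set.singleton_mul_singleton, ← Submodule.span_mul_span, Submodule.mul_sup, sup_le_iff]
    refine ⟨?_, ?_⟩
    · rw [mul_right_comm]
      exact (mul_le_mul' hgV ((Submodule.span_singleton_le_iff_mem _ _).mpr he)).trans mul_le
    · rw [mul_assoc]
      exact (mul_le_mul' ((Submodule.span_singleton_le_iff_mem _ _).mpr hg) heW).trans mul_le

lemma adjoin_le_ratioField_pow {Y : Submodule k K} (h1 : 1 ∈ Y) :
    IntermediateField.adjoin k (Y : Set K) ≤ ratioField fun n => Y ^ n :=
  IntermediateField.adjoin_le_iff.mpr fun y hy => by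
    simpa using div_mem_ratioField (L := fun n => Y ^ n) (a := 1) (f := y) (g := 1)
      (by simpa using hy) (by simpa using h1)

end RatioField

section Dimension

variable {k K : Type*} [Field k] [Field K] [Algebra k K]

lemma finrank_le_finrank_mul (V : Submodule k K) {W : Submodule k K} [FiniteDimensional k V]
    [FiniteDimensional k W] (hW : W ≠ ⊥) :
    Module.finrank k V ≤ Module.finrank k (V * W : Submodule k K) := by
  obtain ⟨w, hw, hw0⟩ := W.ne_bot_iff.mp hW
  exact LinearMap.finrank_le_finrank_of_injective
    (f := (LinearMap.mulRight k w).restrict fun v hv => Submodule.mul_mem_mul hv hw)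
    fun a b hab => Subtype.ext (mul_right_cancel₀ hw0 (congrArg Subtype.val hab))

lemma finrank_mul_le (V W : Submodule k K) [FiniteDimensional k V] [FiniteDimensional k W] :
    Module.finrank k (V * W : Submodule k K) ≤ Module.finrank k V * Module.finrank k W := by
  rw [← Submodule.mulMap_range, ← Module.finrank_tensorProduct]
  exact LinearMap.finrank_range_le _

instance finiteDimensional_prod {ι : Type*} (s : Finset ι) (V : ι → Submodule k K)
    [∀ i, FiniteDimensional k (V i)] : FiniteDimensional k (∏ i ∈ s, V i : Submodule k K) := by
  classical
  induction s using Finset.induction_on with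
  | empty =>
    rw [Finset.prod_empty, Submodule.one_eq_span]
    infer_instance
  | insert i s hi ih =>
    rw [Finset.prod_insert hi]
    infer_instance

lemma finrank_prod_le {ι : Type*} (s : Finset ι) (V : ι → Submodule k K)
    [∀ i, FiniteDimensional k (V i)] :
    Module.finrank k (∏ i ∈ s, V i : Submodule k K) ≤ ∏ i ∈ s, Module.finrank k (V i) := by
  classical
  induction s using Finset.induction_on with
  | empty =>
    rw [Finset.prod_empty, Finset.prod_empty, Submodule.one_eq_span, finrank_span_singleton]
    exact one_ne_zero
  | insert i s hi ih =>
    rw [Finset.prod_insert hi, Finset.prod_insert hi]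
    exact (finrank_mul_le _ _).trans (Nat.mul_le_mul_left _ ih)

lemma finrank_span_pair_pow_le (x : K) (m : ℕ) :
    Module.finrank k (Submodule.span k {1, x} ^ m : Submodule k K) ≤ m + 1 := by
  have pow_le : (Submodule.span k {1, x} : Submodule k K) ^ m ≤
      Submodule.span k (Set.range fun i : Fin (m + 1) => x ^ (i : ℕ)) := by
    induction m with
    | zero => simp [Submodule.one_eq_span]
    | succ m ih =>
      rw [pow_succ]
      refine (mul_le_mul' ih le_rfl).trans ?_
      rw [Submodule.span_mul_span, Submodule.span_le]
      rintro _ ⟨_, ⟨i, rfl⟩, _, rfl | rfl, rfl⟩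
      · exact Submodule.subset_span ⟨i.castSucc, by simp⟩
      · exact Submodule.subset_span ⟨i.succ, by simp [pow_succ]⟩
  have := FiniteDimensional.span_of_finite k (Set.finite_range fun i : Fin (m + 1) => x ^ (i : ℕ))
  exact (Submodule.finrank_mono pow_le).trans ((finrank_range_le_card _).trans_eq (by simp))

end Dimension

section PowerGrowth

open IntermediateField

variable {k K : Type*} [Field k] [Field K] [Algebra k K]

lemma exists_le_mul_span_basis (F : IntermediateField k K) {ι : Type*} [Finite ι]
    (b : Module.Basis ι F K) {V : Submodule k K} (hV : V.FG) :
    ∃ W : Submodule k K, W.FG ∧ (∀ w ∈ W, w ∈ F) ∧ V ≤ W * Submodule.span k (Set.range b) := by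
  have := Fintype.ofFinite ι
  induction V, hV using Submodule.fg_induction with
  | singleton v =>
    refine ⟨Submodule.span k (Set.range fun i => (b.repr v i : K)),
      Submodule.fg_span (Set.finite_range _), fun w hw => ?_, ?_⟩
    · exact (Submodule.span_le (p := Subalgebra.toSubmodule F.toSubalgebra)).mpr
        (Set.range_subset_iff.mpr fun i => (b.repr v i).2) hw
    · rw [Submodule.span_singleton_le_iff_mem, ← b.sum_repr v]
      exact Submodule.sum_mem _ fun i _ => Submodule.mul_mem_mul
        (Submodule.subset_span ⟨i, by rw [b.sum_repr]⟩) (Submodule.subset_span ⟨i, rfl⟩)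
  | sup V V' _ _ ih ih' =>
    obtain ⟨W, hW, hWF, hVW⟩ := ih
    obtain ⟨W', hW', hWF', hVW'⟩ := ih'
    refine ⟨W ⊔ W', hW.sup hW', fun w hw => ?_, ?_⟩
    · exact sup_le (c := Subalgebra.toSubmodule F.toSubalgebra) hWF hWF' hw
    · rw [Submodule.sup_mul]
      exact sup_le_sup hVW hVW'

/-- The subspace `∏ x ∈ s, ⟨1, x⟩`, spanned by the products of distinct elements of `s`; its
`m`-th power has dimension at most `(m + 1) ^ s.card`. -/
def multilinearSpan (k : Type*) {K : Type*} [Field k] [Field K] [Algebra k K] (s : Finset K) :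
    Submodule k K :=
  ∏ x ∈ s, Submodule.span k {1, x}

instance finiteDimensional_multilinearSpan (s : Finset K) :
    FiniteDimensional k (multilinearSpan k s) := by
  have (x : K) : FiniteDimensional k (Submodule.span k {1, x}) :=
    FiniteDimensional.span_of_finite k (Set.toFinite _)
  exact finiteDimensional_prod s _

lemma finrank_multilinearSpan_pow_le (s : Finset K) (m : ℕ) :
    Module.finrank k (multilinearSpan k s ^ m : Submodule k K) ≤ (m + 1) ^ s.card := by
  have (x : K) : FiniteDimensional k (Submodule.span k {1, x}) :=
    FiniteDimensional.span_of_finite k (Set.toFinite _)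
  rw [multilinearSpan, ← Finset.prod_pow, ← Finset.prod_const]
  exact (finrank_prod_le _ _).trans (Finset.prod_le_prod' fun x _ => finrank_span_pair_pow_le x m)

lemma one_mem_multilinearSpan (s : Finset K) : 1 ∈ multilinearSpan k s :=
  Submodule.one_le.mp <| Finset.one_le_prod' fun _ _ =>
    Submodule.one_le.mpr (Submodule.subset_span (Set.mem_insert _ _))

lemma mem_multilinearSpan {s : Finset K} {x : K} (hx : x ∈ s) : x ∈ multilinearSpan k s :=
  Finset.single_le_prod' (f := fun x => (Submodule.span k {1, x} : Submodule k K))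
    (fun _ _ => Submodule.one_le.mpr (Submodule.subset_span (Set.mem_insert _ _))) hx
    (Submodule.subset_span (Set.mem_insert_of_mem _ rfl))

lemma exists_pow_mul_span_basis_le {F : IntermediateField k K} {ι : Type*} [Finite ι]
    (b : Module.Basis ι F K) {Y : Submodule k K} (hY : F ≤ ratioField fun n => Y ^ n)
    (V : Submodule k K) [FiniteDimensional k V] :
    ∃ c, ∃ g : K, g ≠ 0 ∧ ∀ m, (Submodule.span k {g} * V) ^ m * Submodule.span k (Set.range b) ≤
      Y ^ (c * m) * Submodule.span k (Set.range b) := by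
  set B := Submodule.span k (Set.range b)
  have : FiniteDimensional k B := FiniteDimensional.span_of_finite k (Set.finite_range b)
  obtain ⟨W, hW, hWF, hVW⟩ :=
    exists_le_mul_span_basis F b (V := V * B) (Module.Finite.iff_fg.mp inferInstance)
  obtain ⟨c, g, -, hg, hgW⟩ := exists_common_denominator hW fun w hw => hY (hWF w hw)
  refine ⟨c, g, hg, fun m => ?_⟩
  induction m with
  | zero => simp
  | succ m ih =>
    calc (Submodule.span k {g} * V) ^ (m + 1) * B
        = Submodule.span k {g} * V * ((Submodule.span k {g} * V) ^ m * B) := by ring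
      _ ≤ Submodule.span k {g} * V * (Y ^ (c * m) * B) := mul_le_mul' le_rfl ih
      _ = Submodule.span k {g} * (V * B) * Y ^ (c * m) := by ring
      _ ≤ Submodule.span k {g} * (W * B) * Y ^ (c * m) := by gcongr
      _ = Submodule.span k {g} * W * (Y ^ (c * m) * B) := by ring
      _ ≤ Y ^ c * (Y ^ (c * m) * B) := mul_le_mul' hgW le_rfl
      _ = Y ^ (c * (m + 1)) * B := by ring

theorem exists_finrank_pow_le [Algebra.EssFiniteType k K] {t : ℕ} (ht : Algebra.trdeg k K = t)
    (V : Submodule k K) [FiniteDimensional k V] :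
    ∃ C : ℕ, ∀ m, Module.finrank k (V ^ m : Submodule k K) ≤ C * (m + 1) ^ t := by
  obtain ⟨s, hs⟩ := exists_isTranscendenceBasis k K
  have card_s := hs.cardinalMk_eq_trdeg.trans ht
  lift s to Finset K using
    Cardinal.lt_aleph0_iff_set_finite.mp (card_s ▸ Cardinal.natCast_lt_aleph0)
  replace card_s : s.card = t := by simpa using card_s
  have algebraic := hs.isAlgebraic_field
  rw [Subtype.range_coe] at algebraic
  have : Algebra.EssFiniteType (adjoin k (s : Set K)) K := .of_comp k _ K
  have : FiniteDimensional (adjoin k (s : Set K)) K :=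
    Algebra.finite_of_essFiniteType_of_isAlgebraic
  let b := Module.finBasis (adjoin k (s : Set K)) K
  set B := Submodule.span k (Set.range b)
  have : FiniteDimensional k B := FiniteDimensional.span_of_finite k (Set.finite_range b)
  have adjoin_le : adjoin k (s : Set K) ≤ ratioField fun n => multilinearSpan k s ^ n :=
    (adjoin.mono k _ _ fun _ => mem_multilinearSpan).trans
      (adjoin_le_ratioField_pow (one_mem_multilinearSpan s))
  obtain ⟨c, g, hg, hgV⟩ := exists_pow_mul_span_basis_le b adjoin_le V
  have basis_ne_bot : B ≠ ⊥ := B.ne_bot_iff.mpr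
    ⟨b ⟨0, Module.finrank_pos⟩, Submodule.subset_span ⟨_, rfl⟩, b.ne_zero _⟩
  have ne_bot (m : ℕ) : Submodule.span k {g} ^ m * B ≠ ⊥ :=
    mul_ne_zero (pow_ne_zero m (by simpa using hg)) basis_ne_bot
  refine ⟨(c + 1) ^ t * Module.finrank k B, fun m => ?_⟩
  calc Module.finrank k (V ^ m : Submodule k K)
      ≤ Module.finrank k (V ^ m * (Submodule.span k {g} ^ m * B) : Submodule k K) :=
        finrank_le_finrank_mul _ (ne_bot m)
    _ = Module.finrank k ((Submodule.span k {g} * V) ^ m * B : Submodule k K) := by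
        rw [mul_pow, mul_left_comm, mul_assoc]
    _ ≤ Module.finrank k (multilinearSpan k s ^ (c * m) * B : Submodule k K) :=
        Submodule.finrank_mono (hgV m)
    _ ≤ (c * m + 1) ^ t * Module.finrank k B := (finrank_mul_le _ _).trans
        (Nat.mul_le_mul_right _ (card_s ▸ finrank_multilinearSpan_pow_le s _))
    _ ≤ ((c + 1) * (m + 1)) ^ t * Module.finrank k B := by
        gcongr
        nlinarith
    _ = (c + 1) ^ t * Module.finrank k B * (m + 1) ^ t := by
        rw [mul_pow, mul_right_comm]

end PowerGrowth

section SaturatedPowerGrowth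

variable {k K : Type*} [Field k] [Field K] [Algebra k K]

lemma succ_pow_mul_le_brunnMinkowskiSum (t j : ℕ) {a b : ℝ} (ha : 0 ≤ a)
    (hb : ((j : ℝ) + 1) ^ t * a ≤ b) : ((j : ℝ) + 2) ^ t * a ≤ brunnMinkowskiSum t a b := by
  refine le_trans ?_ (brunnMinkowskiSum_mono t ha (by positivity) le_rfl hb)
  cases t with
  | zero => simp [brunnMinkowskiSum]
  | succ t =>
    have pow_root {x : ℝ} (hx : 0 ≤ x) : (x ^ (t + 1)) ^ (1 / ((t : ℝ) + 1)) = x := by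
      simpa using Real.pow_rpow_inv_natCast hx t.succ_ne_zero
    have root_pow : (a ^ (1 / ((t : ℝ) + 1))) ^ (t + 1) = a := by
      simpa using Real.rpow_inv_natCast_pow ha t.succ_ne_zero
    rw [brunnMinkowskiSum, Real.mul_rpow (by positivity) ha, pow_root (by positivity)]
    nth_rewrite 1 [← root_pow]
    rw [← mul_pow]
    exact le_of_eq (by ring)

lemma HasLinearBrunnMinkowski.exists_succ_pow_mul_finrank_le {t : ℕ}
    (h : HasLinearBrunnMinkowski t k K) :
    ∃ E : Submodule k K, FiniteDimensional k E ∧ ∀ V : Submodule k K, FiniteDimensional k V →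
      ∀ i, (i + 1) ^ t * Module.finrank k V ≤
        Module.finrank k ((E * V) ^ i * V : Submodule k K) := by
  obtain ⟨E, _, hE⟩ := h
  refine ⟨E, inferInstance, fun V _ i => ?_⟩
  obtain rfl | hV := eq_or_ne V ⊥
  · simp
  have finrank_pos : 0 < Module.finrank k V := by
    rwa [Module.finrank_pos_iff, Submodule.nontrivial_iff_ne_bot]
  induction i with
  | zero => rw [pow_zero, one_mul, zero_add, one_pow, one_mul]
  | succ i ih =>
    have ne_bot : (E * V) ^ i * V ≠ ⊥ := by
      intro h
      rw [h, finrank_bot] at ih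
      exact ih.not_gt (by positivity)
    have brunn_minkowski := (succ_pow_mul_le_brunnMinkowskiSum t i (Nat.cast_nonneg _)
      (by exact_mod_cast ih)).trans (hE V ((E * V) ^ i * V) inferInstance inferInstance hV ne_bot)
    rw [← mul_assoc, ← pow_succ'] at brunn_minkowski
    exact_mod_cast brunn_minkowski

lemma mul_pow_mul_mul_pow_le {Y D V : Submodule k K} {e m j : ℕ} (hD : D ≤ Y ^ e)
    (hV : V * Y ^ j ≤ Y ^ (m + j)) (i : ℕ) :
    (D * V) ^ i * V * Y ^ j ≤ Y ^ ((i + 1) * m + i * e + j) := by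
  induction i with
  | zero => simpa using hV
  | succ i ih =>
    calc (D * V) ^ (i + 1) * V * Y ^ j = D * V * ((D * V) ^ i * V * Y ^ j) := by ring
      _ ≤ D * V * Y ^ ((i + 1) * m + i * e + j) := mul_le_mul' le_rfl ih
      _ = D * (V * Y ^ j) * Y ^ ((i + 1) * m + i * e) := by ring
      _ ≤ Y ^ e * Y ^ (m + j) * Y ^ ((i + 1) * m + i * e) :=
        mul_le_mul' (mul_le_mul' hD hV) le_rfl
      _ = Y ^ ((i + 1 + 1) * m + (i + 1) * e + j) := by ring

/- The linear Brunn–Minkowski inequality makes up for the unknown power `j` of `Y` by which `V`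
fails to lie in `Y ^ m`: `(E V) ^ j V` has dimension at least `(j + 1) ^ t dim V`, but lies in a
power of `Y` of exponent about `(j + 1) m`. -/
theorem exists_finrank_le_of_le_saturatedPow [Algebra.EssFiniteType k K] {t : ℕ}
    (ht : Algebra.trdeg k K = t) {Y : Submodule k K} [FiniteDimensional k Y] (h1 : 1 ∈ Y)
    (hY : IntermediateField.adjoin k (Y : Set K) = ⊤) :
    ∃ C : ℕ, ∀ m, ∀ V : Submodule k K, FiniteDimensional k V → V ≤ saturatedPow Y m →
      Module.finrank k V ≤ C * (m + 1) ^ t := by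
  obtain ⟨E, _, hE⟩ := (hasLinearBrunnMinkowski_of_trdeg_eq ht).exists_succ_pow_mul_finrank_le
  obtain ⟨e, g, -, hg, hgE⟩ := exists_common_denominator (L := fun n => Y ^ n)
    (V := E) (Module.Finite.iff_fg.mp inferInstance)
    fun v _ => adjoin_le_ratioField_pow h1 (hY ▸ IntermediateField.mem_top)
  obtain ⟨C, hC⟩ := exists_finrank_pow_le ht Y
  refine ⟨C * (e + 1) ^ t, fun m V _ hV => ?_⟩
  obtain ⟨j, hj⟩ := exists_mul_pow_le_of_le_saturatedPow V hV
  have ne_bot : Submodule.span k {g} ^ j * Y ^ j ≠ ⊥ :=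
    mul_ne_zero (pow_ne_zero _ (by simpa using hg))
      (pow_ne_zero _ ((Submodule.ne_bot_iff _).mpr ⟨1, h1, one_ne_zero⟩))
  have amplified : (j + 1) ^ t * Module.finrank k V ≤
      (j + 1) ^ t * (C * (e + 1) ^ t * (m + 1) ^ t) :=
    calc (j + 1) ^ t * Module.finrank k V
        ≤ Module.finrank k ((E * V) ^ j * V : Submodule k K) := hE V inferInstance j
      _ ≤ Module.finrank k ((E * V) ^ j * V * (Submodule.span k {g} ^ j * Y ^ j) :
          Submodule k K) := finrank_le_finrank_mul _ ne_bot
      _ = Module.finrank k ((Submodule.span k {g} * E * V) ^ j * V * Y ^ j : Submodule k K) := by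
        rw [mul_assoc (Submodule.span k {g}), mul_pow (Submodule.span k {g}), ← mul_assoc,
          mul_comm _ (Submodule.span k {g} ^ j), ← mul_assoc]
      _ ≤ Module.finrank k (Y ^ ((j + 1) * m + j * e + j) : Submodule k K) :=
        Submodule.finrank_mono (mul_pow_mul_mul_pow_le hgE hj j)
      _ ≤ C * ((j + 1) * m + j * e + j + 1) ^ t := hC _
      _ ≤ C * ((j + 1) * ((e + 1) * (m + 1))) ^ t := by
        gcongr
        nlinarith [Nat.zero_le (j * e * m), Nat.zero_le (e * m)]
      _ = (j + 1) ^ t * (C * (e + 1) ^ t * (m + 1) ^ t) := by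
        simp only [mul_pow]
        ring
  exact Nat.le_of_mul_le_mul_left amplified (by positivity)

end SaturatedPowerGrowth

section SubfieldRatios

variable {k K : Type*} [Field k] [Field K] [Algebra k K]

lemma finrank_map_of_injective {V W : Type*} [AddCommGroup V] [Module k V] [AddCommGroup W]
    [Module k W] {f : V →ₗ[k] W} (hf : Function.Injective f) (P : Submodule k V) :
    Module.finrank k (P.map f) = Module.finrank k P :=
  (Submodule.equivMapOfInjective f hf P).finrank_eq.symm

lemma finrank_span_singleton_mul {g : K} (hg : g ≠ 0) (V : Submodule k K) :
    Module.finrank k (Submodule.span k {g} * V : Submodule k K) = Module.finrank k V := by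
  rw [Submodule.span_singleton_mul]
  exact finrank_map_of_injective (f := DistribSMul.toLinearMap k K g) (mul_right_injective₀ hg) V

lemma exists_eq_span_singleton_mul_map {F : IntermediateField k K} {V : Submodule k K}
    [FiniteDimensional k V] (hVF : ∀ v ∈ V, ∀ w ∈ V, v / w ∈ F) (hV : V ≠ ⊥) :
    ∃ g : K, g ≠ 0 ∧ ∃ U : Submodule k F, FiniteDimensional k U ∧
      V = Submodule.span k {g} * U.map F.val.toLinearMap := by
  obtain ⟨g, hg, hg0⟩ := V.ne_bot_iff.mp hV
  let U := (Submodule.span k {g⁻¹} * V).comap F.val.toLinearMap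
  have map_U : U.map F.val.toLinearMap = Submodule.span k {g⁻¹} * V := by
    refine Submodule.map_comap_eq_self fun f hf => ?_
    obtain ⟨v, hv, rfl⟩ := Submodule.mem_span_singleton_mul.mp hf
    exact ⟨⟨_, hVF v hv g hg⟩, div_eq_inv_mul v g⟩
  refine ⟨g, hg0, U, ?_, ?_⟩
  · exact Module.Finite.equiv ((LinearEquiv.ofEq _ _ map_U).symm.trans
      (Submodule.equivMapOfInjective F.val.toLinearMap F.val.injective U).symm)
  · rw [map_U, ← mul_assoc, Submodule.span_mul_span, Set.singleton_mul_singleton,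
      mul_inv_cancel₀ hg0, ← Submodule.one_eq_span, one_mul]

lemma HasLinearBrunnMinkowski.exists_le_finrank_of_div_mem {d : ℕ} {F : IntermediateField k K}
    (h : HasLinearBrunnMinkowski d k F) :
    ∃ E : Submodule k K, FiniteDimensional k E ∧ (∀ x ∈ E, x ∈ F) ∧ ∀ V W : Submodule k K,
      FiniteDimensional k V → FiniteDimensional k W → V ≠ ⊥ → W ≠ ⊥ →
      (∀ v ∈ V, ∀ w ∈ V, v / w ∈ F) → (∀ v ∈ W, ∀ w ∈ W, v / w ∈ F) →
      brunnMinkowskiSum d (Module.finrank k V) (Module.finrank k W) ≤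
        Module.finrank k (E * V * W : Submodule k K) := by
  obtain ⟨E, _, hE⟩ := h
  have injective : Function.Injective F.val.toLinearMap := F.val.injective
  refine ⟨E.map F.val.toLinearMap, inferInstance, ?_, fun V W _ _ hV hW hVF hWF => ?_⟩
  · rintro _ ⟨x, -, rfl⟩
    exact x.2
  obtain ⟨g, hg, V', _, rfl⟩ := exists_eq_span_singleton_mul_map hVF hV
  obtain ⟨e, he, W', _, rfl⟩ := exists_eq_span_singleton_mul_map hWF hW
  have factor : E.map F.val.toLinearMap * (Submodule.span k {g} * V'.map F.val.toLinearMap) *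
      (Submodule.span k {e} * W'.map F.val.toLinearMap) =
      Submodule.span k {g} * (Submodule.span k {e} * (E * V' * W').map F.val.toLinearMap) := by
    rw [Submodule.map_mul, Submodule.map_mul]
    ac_rfl
  rw [factor]
  simp only [finrank_span_singleton_mul hg, finrank_span_singleton_mul he,
    finrank_map_of_injective injective]
  refine hE V' W' inferInstance inferInstance ?_ ?_
  · rintro rfl
    simp at hV
  · rintro rfl
    simp at hW

lemma finrank_mul_card_le {F : IntermediateField k K} {V : Submodule k K} [FiniteDimensional k V]
    (hVF : ∀ v ∈ V, ∀ w ∈ V, v / w ∈ F) {ι : Type*} [Fintype ι] {y : ι → K}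
    (hy : LinearIndependent F y) :
    Module.finrank k V * Fintype.card ι ≤
      Module.finrank k (V * Submodule.span k (Set.range y) : Submodule k K) := by
  obtain rfl | hV := eq_or_ne V ⊥
  · simp
  obtain ⟨g, hg, U, _, rfl⟩ := exists_eq_span_singleton_mul_map hVF hV
  let b := Module.finBasis k U
  have b_indep : LinearIndependent k fun i => (b i : F) :=
    b.linearIndependent.map' U.subtype U.ker_subtype
  have := FiniteDimensional.span_of_finite k (Set.finite_range y)
  rw [mul_assoc, finrank_span_singleton_mul hg, finrank_span_singleton_mul hg,
    finrank_map_of_injective F.val.injective]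
  calc Module.finrank k U * Fintype.card ι
      = Fintype.card (Fin (Module.finrank k U) × ι) := by simp
    _ = Module.finrank k (Submodule.span k (Set.range fun p : Fin (Module.finrank k U) × ι =>
        (b p.1 : F) • y p.2)) := (finrank_span_eq_card (linearIndependent_smul b_indep hy)).symm
    _ ≤ Module.finrank k (U.map F.val.toLinearMap * Submodule.span k (Set.range y) :
        Submodule k K) :=
      Submodule.finrank_mono <| Submodule.span_le.mpr <| Set.range_subset_iff.mpr fun p =>
        Submodule.mul_mem_mul (Submodule.mem_map_of_mem (f := F.val.toLinearMap) (b p.1).2)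
          (Submodule.subset_span (Set.mem_range_self p.2))

end SubfieldRatios

section RatioFieldGrowth

variable {k K : Type*} [Field k] [Field K] [Algebra k K]

lemma linearIndependent_prod_pow {F ι : Type*} [Field F] [Algebra F K] [Fintype ι] {z : ι → K}
    (hz : AlgebraicIndependent F z) (m : ℕ) :
    LinearIndependent F fun α : ι → Fin m => ∏ i, z i ^ (α i : ℕ) := by
  have monomials := ((MvPolynomial.basisMonomials ι F).linearIndependent.map'
    (MvPolynomial.aeval (R := F) z).toLinearMap (LinearMap.ker_eq_bot.mpr hz)).comp
    (fun α : ι → Fin m => Finsupp.equivFunOnFinite.symm fun i => (α i : ℕ)) fun α β h => by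
      funext i
      exact Fin.ext (congrFun (Finsupp.equivFunOnFinite.symm.injective h) i)
  simpa [Function.comp_def, MvPolynomial.aeval_monomial, Finsupp.prod_fintype] using monomials

lemma prod_pow_mem_pow {ι : Type*} [Fintype ι] {Y : Submodule k K} (h1 : 1 ∈ Y) {z : ι → K}
    (hz : ∀ i, z i ∈ Y) {m : ℕ} (α : ι → Fin (m + 1)) :
    ∏ i, z i ^ (α i : ℕ) ∈ Y ^ (Fintype.card ι * m) := by
  have prod_mem := SetLike.prod_mem_graded (fun n => Y ^ n) (fun _ => m) (fun i => z i ^ (α i : ℕ))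
    (F := Finset.univ) fun i _ => pow_le_pow_right' (Submodule.one_le.mpr h1)
      (Nat.lt_succ_iff.mp (α i).2) (Submodule.pow_mem_pow Y (hz i) _)
  simpa using prod_mem

open IntermediateField

lemma isAlgebraic_adjoin_of_adjoin_eq_top {S : Set K} (hS : adjoin k S = ⊤)
    (F : IntermediateField k K) : Algebra.IsAlgebraic (Algebra.adjoin F S) K := by
  have adjoin_le : Algebra.adjoin k S ≤ (Algebra.adjoin F S).restrictScalars k :=
    Algebra.adjoin_le Algebra.subset_adjoin
  refine ⟨fun x => ?_⟩
  obtain ⟨a, ha, b, hb, rfl⟩ := mem_adjoin_iff_div.mp (hS ▸ mem_top : x ∈ adjoin k S)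
  rw [div_eq_mul_inv]
  exact (isAlgebraic_algebraMap (⟨a, adjoin_le ha⟩ : Algebra.adjoin F S)).mul
    (isAlgebraic_algebraMap (⟨b, adjoin_le hb⟩ : Algebra.adjoin F S)).inv

lemma exists_finset_isTranscendenceBasis_subset {S : Set K} (hS : adjoin k S = ⊤)
    {F : IntermediateField k K} (hF : Algebra.trdeg F K < Cardinal.aleph0) :
    ∃ s : Finset K, ↑s ⊆ S ∧ IsTranscendenceBasis F ((↑) : s → K) := by
  have := isAlgebraic_adjoin_of_adjoin_eq_top hS F
  obtain ⟨s, hsS, hs⟩ := exists_isTranscendenceBasis_subset (R := F) S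
  lift s to Finset K using Cardinal.lt_aleph0_iff_set_finite.mp (hs.cardinalMk_eq_trdeg.trans_lt hF)
  exact ⟨s, hsS, hs⟩

/- Multiplying by the monomials in a transcendence basis of `K` over `ratioField L` multiplies
dimensions, so their number can be divided out of the bound for `saturatedPow Y`. -/
theorem exists_finrank_le_of_ratioField [Algebra.EssFiniteType k K] {Y : Submodule k K}
    [FiniteDimensional k Y] (h1 : 1 ∈ Y) (hY : adjoin k (Y : Set K) = ⊤)
    {L : ℕ → Submodule k K} [SetLike.GradedMonoid L] {r : ℕ}
    (hr : Algebra.trdeg k (ratioField L) = r) {e : ℕ} {h : K} (h0 : h ≠ 0)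
    (hL : ∀ m, ∀ f ∈ L m, f * h ^ m ∈ saturatedPow Y (e * m)) :
    ∃ C : ℕ, ∀ m, ∀ V : Submodule k K, FiniteDimensional k V → V ≤ L m →
      Module.finrank k V ≤ C * (m + 1) ^ r := by
  classical
  have trdeg_add := trdeg_add_eq k (ratioField L) (A := K)
  obtain ⟨s, hsY, hs⟩ := exists_finset_isTranscendenceBasis_subset hY (F := ratioField L)
    ((self_le_add_left _ _).trans_lt (trdeg_add.trans_lt (trdeg_lt_aleph0 k K)))
  have trdeg_eq : Algebra.trdeg k K = (r + s.card : ℕ) := by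
    rw [← trdeg_add, hr, ← hs.cardinalMk_eq_trdeg]
    simp
  obtain ⟨C, hC⟩ := exists_finrank_le_of_le_saturatedPow trdeg_eq h1 hY
  refine ⟨C * (e + s.card + 1) ^ (r + s.card), fun m V _ hV => ?_⟩
  set M := Submodule.span k (Set.range fun α : s → Fin (m + 1) =>
    ∏ i, ((↑) : s → K) i ^ (α i : ℕ))
  have : FiniteDimensional k M := FiniteDimensional.span_of_finite k (Set.finite_range _)
  have monomials_le : M ≤ saturatedPow Y (s.card * m) :=
    Submodule.span_le.mpr <| Set.range_subset_iff.mpr fun α => pow_le_saturatedPow _ <| by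
      simpa using prod_pow_mem_pow h1 (fun i : s => hsY i.2) α
  have product_le : Submodule.span k {h ^ m} * (V * M) ≤ saturatedPow Y (e * m + s.card * m) := by
    rw [← mul_assoc, Submodule.mul_le]
    intro f hf z hz
    obtain ⟨v, hv, rfl⟩ := Submodule.mem_span_singleton_mul.mp hf
    rw [mul_comm (h ^ m)]
    exact SetLike.mul_mem_graded (hL m v (hV hv)) (monomials_le hz)
  have amplified : Module.finrank k V * (m + 1) ^ s.card ≤
      C * (e + s.card + 1) ^ (r + s.card) * (m + 1) ^ r * (m + 1) ^ s.card :=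
    calc Module.finrank k V * (m + 1) ^ s.card
        = Module.finrank k V * Fintype.card (s → Fin (m + 1)) := by simp
      _ ≤ Module.finrank k (V * M : Submodule k K) := finrank_mul_card_le
          (fun v hv w hw => div_mem_ratioField (hV hv) (hV hw)) (linearIndependent_prod_pow hs.1 _)
      _ = Module.finrank k (Submodule.span k {h ^ m} * (V * M) : Submodule k K) :=
        (finrank_span_singleton_mul (pow_ne_zero m h0) _).symm
      _ ≤ C * (e * m + s.card * m + 1) ^ (r + s.card) := hC _ _ inferInstance product_le
      _ ≤ C * ((e + s.card + 1) * (m + 1)) ^ (r + s.card) := by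
        gcongr
        nlinarith
      _ = C * (e + s.card + 1) ^ (r + s.card) * (m + 1) ^ r * (m + 1) ^ s.card := by
        rw [mul_pow, pow_add (m + 1)]
        ring
  exact Nat.le_of_mul_le_mul_right amplified (by positivity)

end RatioFieldGrowth

/-! ### Asymptotics of almost superadditive sequences -/

section Asymptotics

open Filter Topology
open scoped ENNReal

lemma liminf_add_liminf_le {ι : Type*} (f : Filter ι) (u v : ι → ℝ≥0∞) :
    liminf u f + liminf v f ≤ liminf (fun i => u i + v i) f := by
  simp only [liminf_eq_iSup_iInf]
  refine ENNReal.biSup_add_biSup_le' ⟨_, f.univ_mem⟩ ⟨_, f.univ_mem⟩ fun s hs t ht => ?_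
  refine le_iSup₂_of_le (s ∩ t) (inter_mem hs ht) (le_iInf₂ fun i hi => ?_)
  exact add_le_add (iInf₂_le i hi.1) (iInf₂_le i hi.2)

lemma tendsto_natCast_div_natCast {f g : ℕ → ℕ} {c : ℝ} (hg : ∀ᶠ j in atTop, g j ≠ 0)
    (h : Tendsto (fun j => (f j : ℝ) / g j) atTop (𝓝 c)) :
    Tendsto (fun j => (f j : ℝ≥0∞) / g j) atTop (𝓝 (ENNReal.ofReal c)) := by
  refine (ENNReal.tendsto_ofReal h).congr' ?_
  filter_upwards [hg] with j hj
  rw [ENNReal.ofReal_div_of_pos (Nat.cast_pos.mpr (Nat.pos_of_ne_zero hj)),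
    ENNReal.ofReal_natCast, ENNReal.ofReal_natCast]

lemma tendsto_mul_div_div_add {g : ℕ} (hg : 0 < g) (M b : ℕ) :
    Tendsto (fun j : ℕ => ((g * (j / M) : ℕ) : ℝ≥0∞) / (g * j + b : ℕ)) atTop
      (𝓝 (ENNReal.ofReal (M : ℝ)⁻¹)) := by
  have g_ne_zero : (g : ℝ) ≠ 0 := Nat.cast_ne_zero.mpr hg.ne'
  have floor_ratio : Tendsto (fun j : ℕ => ((j / M : ℕ) : ℝ) / j) atTop (𝓝 (M : ℝ)⁻¹) := by
    refine ((tendsto_nat_floor_mul_div_atTop (inv_nonneg.mpr M.cast_nonneg)).comp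
      tendsto_natCast_atTop_atTop).congr fun j => ?_
    rw [Function.comp_apply, inv_mul_eq_div, Nat.floor_div_eq_div]
  have shift_ratio : Tendsto (fun j : ℕ => ((g : ℝ) * j) / (b + g * j)) atTop (𝓝 1) := by
    simpa [g_ne_zero] using tendsto_add_mul_div_add_mul_atTop_nhds 0 (b : ℝ) (g : ℝ) g_ne_zero
  refine tendsto_natCast_div_natCast ?_ ?_
  · filter_upwards [eventually_gt_atTop 0] with j hj
    positivity
  · rw [← mul_one (M : ℝ)⁻¹]
    refine (floor_ratio.mul shift_ratio).congr' ?_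
    filter_upwards [eventually_gt_atTop 0] with j hj
    have : (j : ℝ) ≠ 0 := Nat.cast_ne_zero.mpr hj.ne'
    push_cast
    field_simp
    ring

lemma limsup_div_le_of_forall_div_add_le {u : ℕ → ℝ≥0∞} {a : ℕ} {S : ℝ≥0∞}
    (h : ∀ m, 0 < m → u m / (m + a : ℕ) ≤ S) :
    limsup (fun m : ℕ => u m / m) atTop ≤ S := by
  have shift_ratio : Tendsto (fun m : ℕ => ((m + a : ℕ) : ℝ≥0∞) / m) atTop (𝓝 1) := by
    rw [← ENNReal.ofReal_one]
    refine tendsto_natCast_div_natCast (eventually_ne_atTop 0) ?_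
    simpa [add_comm] using tendsto_add_mul_div_add_mul_atTop_nhds (a : ℝ) 0 1 one_ne_zero
  have bound_tendsto := ENNReal.Tendsto.const_mul (a := S) shift_ratio (.inl one_ne_zero)
  rw [mul_one] at bound_tendsto
  rw [← bound_tendsto.limsup_eq]
  refine limsup_le_limsup ?_
  filter_upwards [eventually_gt_atTop 0] with m hm
  calc u m / m = u m / (m + a : ℕ) * (((m + a : ℕ) : ℝ≥0∞) / m) := by
        rw [← mul_div_assoc, ENNReal.div_mul_cancel (by positivity) (ENNReal.natCast_ne_top _)]
    _ ≤ S * (((m + a : ℕ) : ℝ≥0∞) / m) := by gcongr; exact h m hm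

section Superadditive

variable {u : ℕ → ℝ≥0∞} {N : AddSubmonoid ℕ} {a m : ℕ}
  (hsup : ∀ i ∈ N, ∀ j ∈ N, u i + u j ≤ u (i + j + a))

include hsup

lemma succ_mul_le_of_add_le (ha : a ∈ N) (hm : m ∈ N) (q : ℕ) :
    ((q + 1 : ℕ) : ℝ≥0∞) * u m ≤ u (q * (m + a) + m) := by
  induction q with
  | zero => simp
  | succ q ih =>
    calc ((q + 1 + 1 : ℕ) : ℝ≥0∞) * u m = ((q + 1 : ℕ) : ℝ≥0∞) * u m + u m := by
          push_cast
          ring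
      _ ≤ u (q * (m + a) + m) + u m := by gcongr
      _ ≤ u (q * (m + a) + m + m + a) :=
        hsup _ (add_mem (N.nsmul_mem (add_mem hm ha) q) hm) _ hm
      _ = u ((q + 1) * (m + a) + m) := by ring_nf

lemma mul_div_mul_le_of_add_le (hmono : ∀ i ∈ N, ∀ j ∈ N, u i ≤ u (i + j)) (ha : a ∈ N)
    (hm : m ∈ N) {g : ℕ} (hg : g ∈ N) (j : ℕ) :
    ((g * (j / (m + a)) : ℕ) : ℝ≥0∞) * u m ≤ u (g * j) := by
  obtain hq | hq := eq_or_ne (g * (j / (m + a))) 0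
  · simp [hq]
  obtain ⟨q, hq⟩ := Nat.exists_eq_succ_of_ne_zero hq
  have split : g * j = q * (m + a) + m + (a + j % (m + a) * g) := by
    calc g * j = g * ((m + a) * (j / (m + a)) + j % (m + a)) := by rw [Nat.div_add_mod]
      _ = g * (j / (m + a)) * (m + a) + j % (m + a) * g := by ring
      _ = q * (m + a) + m + (a + j % (m + a) * g) := by rw [hq, Nat.succ_eq_add_one]; ring
  rw [hq, split]
  exact (succ_mul_le_of_add_le hsup ha hm q).trans <|
    hmono _ (add_mem (N.nsmul_mem (add_mem hm ha) q) hm) _ (add_mem ha (N.nsmul_mem hg _))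

theorem mul_limsup_div_le_liminf_div (hmono : ∀ i ∈ N, ∀ j ∈ N, u i ≤ u (i + j))
    (hzero : ∀ m ∉ N, u m = 0) (ha : a ∈ N) {g : ℕ} (hg : g ∈ N) (hg0 : 0 < g) (p b : ℕ) :
    p * limsup (fun m : ℕ => u m / m) atTop ≤
      liminf (fun j : ℕ => u (p * (g * j)) / (g * j + b : ℕ)) atTop := by
  rw [← ENNReal.limsup_const_mul_of_ne_top (ENNReal.natCast_ne_top p)]
  simp only [← mul_div_assoc]
  refine limsup_div_le_of_forall_div_add_le (a := a) fun m hm => ?_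
  by_cases hmN : m ∈ N
  swap
  · simp [hzero m hmN]
  have bound_tendsto := ENNReal.Tendsto.mul_const (b := p * u m)
    (tendsto_mul_div_div_add hg0 (m + a) b) (.inl (by positivity))
  rw [ENNReal.ofReal_inv_of_pos (by positivity), ENNReal.ofReal_natCast] at bound_tendsto
  rw [div_eq_mul_inv, mul_comm, ← bound_tendsto.liminf_eq]
  refine liminf_le_liminf (Eventually.of_forall fun j => ?_)
  calc ((g * (j / (m + a)) : ℕ) : ℝ≥0∞) / (g * j + b : ℕ) * (p * u m)
      = ((p * g * (j / (m + a)) : ℕ) : ℝ≥0∞) * u m / (g * j + b : ℕ) := by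
        push_cast
        simp only [div_eq_mul_inv]
        ring
    _ ≤ u (p * (g * j)) / (g * j + b : ℕ) := by
        gcongr
        rw [← mul_assoc]
        exact mul_div_mul_le_of_add_le hsup hmono ha hmN (N.nsmul_mem hg p) j

end Superadditive

lemma limsup_div_pow_rpow {n : ℕ} (hn : 0 < n) (f : ℕ → ℝ≥0∞) :
    limsup (fun m : ℕ => f m / (m : ℝ≥0∞) ^ n) atTop ^ (1 / (n : ℝ)) =
      limsup (fun m : ℕ => f m ^ (1 / (n : ℝ)) / m) atTop := by
  have n_ne_zero : (n : ℝ) ≠ 0 := Nat.cast_ne_zero.mpr hn.ne'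
  have limsup_root := (ENNReal.orderIsoRpow (1 / (n : ℝ)) (by positivity)).limsup_apply
    (f := atTop) (u := fun m : ℕ => f m / (m : ℝ≥0∞) ^ n)
  simp only [ENNReal.orderIsoRpow_apply] at limsup_root
  rw [limsup_root]
  simp only [ENNReal.div_rpow_of_nonneg _ _ (one_div_nonneg.mpr n.cast_nonneg),
    ← ENNReal.rpow_natCast, ← ENNReal.rpow_mul, mul_one_div_cancel n_ne_zero, ENNReal.rpow_one]

lemma le_of_limsup_div_pow_pos {n r C : ℕ} {f : ℕ → ℕ} (hf : ∀ m, f m ≤ C * (m + 1) ^ r)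
    (h : 0 < limsup (fun m : ℕ => (f m : ℝ≥0∞) / (m : ℝ≥0∞) ^ n) atTop) : n ≤ r := by
  by_contra! hlt
  refine h.ne' (le_antisymm ?_ zero_le)
  have bound_tendsto : Tendsto (fun m : ℕ => ((C * 2 ^ r : ℕ) : ℝ≥0∞) * (m : ℝ≥0∞)⁻¹) atTop
      (𝓝 0) := by
    simpa using ENNReal.Tendsto.const_mul ENNReal.tendsto_inv_nat_nhds_zero
      (.inr (ENNReal.natCast_ne_top (C * 2 ^ r)))
  rw [← bound_tendsto.limsup_eq]
  refine limsup_le_limsup ?_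
  filter_upwards [eventually_gt_atTop 0] with m hm
  have m_ne_zero : (m : ℝ≥0∞) ≠ 0 := Nat.cast_ne_zero.mpr hm.ne'
  obtain ⟨c, rfl⟩ := Nat.exists_eq_add_of_lt hlt
  have bound : f m * m ≤ C * 2 ^ r * m ^ (r + c + 1) :=
    calc f m * m ≤ C * (m + m) ^ r * m := by
          gcongr
          exact (hf m).trans (by gcongr; omega)
      _ = C * 2 ^ r * m ^ (r + 1) := by rw [← two_mul, mul_pow]; ring
      _ ≤ C * 2 ^ r * m ^ (r + c + 1) := by
        gcongr
        all_goals omega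
  rw [← div_eq_mul_inv, ENNReal.div_le_iff (by positivity) (by finiteness),
    ← ENNReal.mul_div_right_comm,
    ENNReal.le_div_iff_mul_le (.inl m_ne_zero) (.inl (ENNReal.natCast_ne_top m))]
  exact_mod_cast bound

end Asymptotics

/-! ### Volumes of graded linear series -/

section GradedLinearSeries

open Filter IntermediateField
open scoped ENNReal

lemma rpow_add_rpow_le_of_brunnMinkowskiSum_le {n r : ℕ} (hn : 0 < n) (hr : n ≤ r) {a b c : ℝ}
    (ha : 0 ≤ a) (hb : 0 ≤ b) (h : brunnMinkowskiSum r a b ≤ c) :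
    a ^ (1 / (n : ℝ)) + b ^ (1 / (n : ℝ)) ≤ c ^ (1 / (n : ℝ)) := by
  obtain ⟨r, rfl⟩ := Nat.exists_eq_succ_of_ne_zero (hn.trans_le hr).ne'
  have one_le_ratio : 1 ≤ ((r : ℝ) + 1) * (1 / n) := by
    rw [mul_one_div, one_le_div (Nat.cast_pos.mpr hn)]
    exact_mod_cast hr
  have root_rpow {x : ℝ} (hx : 0 ≤ x) :
      (x ^ (1 / ((r : ℝ) + 1))) ^ (((r : ℝ) + 1) * (1 / n)) = x ^ (1 / (n : ℝ)) := by
    rw [← Real.rpow_mul hx, ← mul_assoc, one_div_mul_cancel (by positivity), one_mul]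
  calc a ^ (1 / (n : ℝ)) + b ^ (1 / (n : ℝ))
      ≤ (a ^ (1 / ((r : ℝ) + 1)) + b ^ (1 / ((r : ℝ) + 1))) ^ (((r : ℝ) + 1) * (1 / n)) := by
        rw [← root_rpow ha, ← root_rpow hb]
        exact Real.add_rpow_le_rpow_add (by positivity) (by positivity) one_le_ratio
    _ = (brunnMinkowskiSum (r + 1) a b) ^ (1 / (n : ℝ)) := by
        rw [Real.rpow_mul (by positivity), brunnMinkowskiSum, ← Real.rpow_natCast]
        push_cast
        rfl
    _ ≤ c ^ (1 / (n : ℝ)) := by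
        have : 0 ≤ brunnMinkowskiSum (r + 1) a b := by
          rw [brunnMinkowskiSum]
          positivity
        gcongr

variable {k K : Type*} [Field k] [Field K] [Algebra k K]

lemma finiteDimensional_of_forall_finrank_le {U : Submodule k K} {n : ℕ}
    (h : ∀ V : Submodule k K, FiniteDimensional k V → V ≤ U → Module.finrank k V ≤ n) :
    FiniteDimensional k U := by
  refine Module.rank_lt_aleph0_iff.mp ((rank_le fun s hs => ?_).trans_lt
    (Cardinal.natCast_lt_aleph0 (n := n)))
  have independent : LinearIndependent k fun i : s => ((i : U) : K) :=
    hs.map' U.subtype U.ker_subtype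
  simpa [finrank_span_eq_card independent] using h _
    (FiniteDimensional.span_of_finite k (Set.finite_range fun i : s => ((i : U) : K)))
    (Submodule.span_le.mpr (Set.range_subset_iff.mpr fun i => (i : U).2))

/-- The `n`-th root of the dimension of `V`, with value `0` for `n ≠ 0` if the dimension is
infinite. -/
def dimRoot (n : ℕ) (V : Submodule k K) : ℝ≥0∞ :=
  (Module.finrank k V : ℝ≥0∞) ^ (1 / (n : ℝ))

lemma dimRoot_bot {n : ℕ} (hn : 0 < n) : dimRoot n (⊥ : Submodule k K) = 0 := by
  simp [dimRoot, hn]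

lemma dimRoot_mono (n : ℕ) {V W : Submodule k K} [FiniteDimensional k W] (h : V ≤ W) :
    dimRoot n V ≤ dimRoot n W :=
  ENNReal.rpow_le_rpow (Nat.cast_le.mpr (Submodule.finrank_mono h)) (by positivity)

lemma dimRoot_add_dimRoot_le {n r : ℕ} (hn : 0 < n) (hr : n ≤ r) {V W U : Submodule k K}
    (h : brunnMinkowskiSum r (Module.finrank k V) (Module.finrank k W) ≤ Module.finrank k U) :
    dimRoot n V + dimRoot n W ≤ dimRoot n U := by
  have cast_rpow (a : ℕ) :
      (a : ℝ≥0∞) ^ (1 / (n : ℝ)) = ENNReal.ofReal ((a : ℝ) ^ (1 / (n : ℝ))) := by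
    rw [← ENNReal.ofReal_natCast, ENNReal.ofReal_rpow_of_nonneg a.cast_nonneg (by positivity)]
  simp only [dimRoot, cast_rpow]
  rw [← ENNReal.ofReal_add (by positivity) (by positivity)]
  exact ENNReal.ofReal_le_ofReal <|
    rpow_add_rpow_le_of_brunnMinkowskiSum_le hn hr (Nat.cast_nonneg _) (Nat.cast_nonneg _) h

section Support

variable (L : ℕ → Submodule k K) [SetLike.GradedMonoid L]

/-- The semigroup of degrees in which a graded linear series is nonzero. -/
def gradedSupport : AddSubmonoid ℕ where
  carrier := {m | L m ≠ ⊥}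
  zero_mem' := (Submodule.ne_bot_iff _).mpr ⟨1, SetLike.one_mem_graded L, one_ne_zero⟩
  add_mem' := by
    intro a b ha hb
    obtain ⟨f, hf, hf0⟩ := (Submodule.ne_bot_iff _).mp ha
    obtain ⟨g, hg, hg0⟩ := (Submodule.ne_bot_iff _).mp hb
    exact (Submodule.ne_bot_iff _).mpr ⟨_, SetLike.mul_mem_graded hf hg, mul_ne_zero hf0 hg0⟩

variable {L}

lemma mem_gradedSupport {m : ℕ} : m ∈ gradedSupport L ↔ ∃ f ∈ L m, f ≠ 0 :=
  Submodule.ne_bot_iff _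

end Support

lemma exists_pos_ne_bot_of_limsup_pos {L : ℕ → Submodule k K} {n : ℕ}
    (h : 0 < limsup (fun m : ℕ => (Module.finrank k (L m) : ℝ≥0∞) / (m : ℝ≥0∞) ^ n) atTop) :
    ∃ m, 0 < m ∧ L m ≠ ⊥ := by
  by_contra! hbot
  refine h.ne' ?_
  rw [limsup_congr (v := fun _ => (0 : ℝ≥0∞)), limsup_const]
  filter_upwards [eventually_gt_atTop 0] with m hm
  rw [hbot m hm, finrank_bot, Nat.cast_zero, ENNReal.zero_div]

/-- The dimensions of the graded linear series `L` are finite and grow at most like `m ^ r`, for an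
exponent `r` in a linear Brunn–Minkowski inequality over the field of ratios of `L`. -/
structure HasBrunnMinkowskiGrowth (r : ℕ) (L : ℕ → Submodule k K) [SetLike.GradedMonoid L] :
    Prop where
  finiteDimensional (m : ℕ) : FiniteDimensional k (L m)
  exists_finrank_le : ∃ C, ∀ m, Module.finrank k (L m) ≤ C * (m + 1) ^ r
  hasLinearBrunnMinkowski : HasLinearBrunnMinkowski r k (ratioField L)

theorem exists_hasBrunnMinkowskiGrowth [Algebra.EssFiniteType k K] {Y : Submodule k K}
    [FiniteDimensional k Y] (h1 : 1 ∈ Y) (hY : adjoin k (Y : Set K) = ⊤)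
    {L : ℕ → Submodule k K} [SetLike.GradedMonoid L] {e : ℕ} {h : K} (h0 : h ≠ 0)
    (hL : ∀ m, ∀ f ∈ L m, f * h ^ m ∈ saturatedPow Y (e * m)) :
    ∃ r, HasBrunnMinkowskiGrowth r L := by
  obtain ⟨r, hr⟩ := Cardinal.lt_aleph0.mp <| (self_le_add_right _ _).trans_lt <|
    (trdeg_add_eq k (ratioField L) (A := K)).trans_lt (trdeg_lt_aleph0 k K)
  obtain ⟨C, hC⟩ := exists_finrank_le_of_ratioField h1 hY hr h0 hL
  have := essFiniteType_intermediateField (ratioField L)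
  have finite (m : ℕ) := finiteDimensional_of_forall_finrank_le (hC m)
  exact ⟨r, finite, ⟨C, fun m => hC m _ (finite m) le_rfl⟩, hasLinearBrunnMinkowski_of_trdeg_eq hr⟩

namespace HasBrunnMinkowskiGrowth

variable {L : ℕ → Submodule k K} [SetLike.GradedMonoid L] {n r : ℕ}

lemma exists_dimRoot_add_le (h : HasBrunnMinkowskiGrowth r L) (hn : 0 < n) (hr : n ≤ r) :
    ∃ a ∈ gradedSupport L, ∀ m, ∀ V W : Submodule k K, FiniteDimensional k V →
      FiniteDimensional k W → V ≠ ⊥ → W ≠ ⊥ → V * W ≤ L m →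
      dimRoot n V + dimRoot n W ≤ dimRoot n (L (m + a)) := by
  have := h.finiteDimensional
  obtain ⟨E, _, E_le, hE⟩ := h.hasLinearBrunnMinkowski.exists_le_finrank_of_div_mem
  obtain ⟨a, g, hg, hg0, gE_le⟩ := exists_common_denominator (Module.Finite.iff_fg.mp ‹_›) E_le
  refine ⟨a, mem_gradedSupport.mpr ⟨g, hg, hg0⟩, fun m V W _ _ hV hW hVW => ?_⟩
  obtain ⟨v₀, hv₀, v₀_ne_zero⟩ := V.ne_bot_iff.mp hV
  obtain ⟨w₀, hw₀, w₀_ne_zero⟩ := W.ne_bot_iff.mp hW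
  have hVF (v) (hv : v ∈ V) (v') (hv' : v' ∈ V) : v / v' ∈ ratioField L := by
    rw [← mul_div_mul_right v v' w₀_ne_zero]
    exact div_mem_ratioField (hVW (Submodule.mul_mem_mul hv hw₀))
      (hVW (Submodule.mul_mem_mul hv' hw₀))
  have hWF (w) (hw : w ∈ W) (w') (hw' : w' ∈ W) : w / w' ∈ ratioField L := by
    rw [← mul_div_mul_left w w' v₀_ne_zero]
    exact div_mem_ratioField (hVW (Submodule.mul_mem_mul hv₀ hw))
      (hVW (Submodule.mul_mem_mul hv₀ hw'))
  have product_le : Submodule.span k {g} * (E * V * W) ≤ L (m + a) := by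
    rw [mul_assoc E, ← mul_assoc, add_comm]
    exact (mul_le_mul' gE_le hVW).trans
      (Submodule.mul_le.mpr fun _ hf _ hg => SetLike.mul_mem_graded hf hg)
  refine dimRoot_add_dimRoot_le hn hr ((hE V W ‹_› ‹_› hV hW hVF hWF).trans ?_)
  rw [← finrank_span_singleton_mul hg0]
  exact_mod_cast Submodule.finrank_mono product_le

lemma mul_limsup_dimRoot_le_liminf (h : HasBrunnMinkowskiGrowth r L) (hn : 0 < n) (hr : n ≤ r)
    {g : ℕ} (hg : g ∈ gradedSupport L) (hg0 : 0 < g) (p b : ℕ) :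
    p * limsup (fun m : ℕ => dimRoot n (L m) / m) atTop ≤
      liminf (fun j : ℕ => dimRoot n (L (p * (g * j))) / (g * j + b : ℕ)) atTop := by
  have := h.finiteDimensional
  obtain ⟨a, ha, superadditive⟩ := h.exists_dimRoot_add_le hn hr
  refine mul_limsup_div_le_liminf_div (u := fun m => dimRoot n (L m))
    (fun i hi j hj => superadditive _ _ _ inferInstance inferInstance hi hj <|
      Submodule.mul_le.mpr fun _ hf _ hg => SetLike.mul_mem_graded hf hg)
    (fun i _ j hj => ?_) (fun m hm => ?_) ha hg hg0 p b
  · obtain ⟨f, hf, hf0⟩ := mem_gradedSupport.mp hj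
    calc dimRoot n (L i) = dimRoot n (Submodule.span k {f} * L i) := by
          rw [dimRoot, dimRoot, finrank_span_singleton_mul hf0]
      _ ≤ dimRoot n (L (i + j)) := dimRoot_mono n <| Submodule.mul_le.mpr fun x hx v hv => by
          obtain ⟨c, rfl⟩ := Submodule.mem_span_singleton.mp hx
          rw [mul_comm]
          exact SetLike.mul_mem_graded hv (Submodule.smul_mem _ c hf)
  · rw [(of_not_not hm : L m = ⊥), dimRoot_bot hn]

variable {L₁ L₂ : ℕ → Submodule k K} [SetLike.GradedMonoid L₁] [SetLike.GradedMonoid L₂] {p q : ℕ}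
  (hmul : ∀ m, L₁ (p * m) * L₂ (q * m) ≤ L m)

include hmul

lemma exists_finrank_le_of_mul_le (h : HasBrunnMinkowskiGrowth r L) (hp : 0 < p) {s : ℕ}
    (hs0 : 0 < s) (hs : s ∈ gradedSupport L₂) :
    ∃ C, ∀ m, Module.finrank k (L₁ m) ≤ C * (m + 1) ^ r := by
  have := h.finiteDimensional
  obtain ⟨C, hC⟩ := h.exists_finrank_le
  obtain ⟨w, hw, hw0⟩ := mem_gradedSupport.mp hs
  refine ⟨C * (s + 1) ^ r, fun m => ?_⟩
  obtain hbot | hm := eq_or_ne (L₁ m) ⊥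
  · rw [hbot, finrank_bot]
    exact Nat.zero_le _
  obtain ⟨f, hf, hf0⟩ := (Submodule.ne_bot_iff _).mp hm
  have degree_eq : m + (p * s - 1) * m = p * (s * m) := by
    obtain ⟨c, hc⟩ := Nat.exists_eq_succ_of_ne_zero (mul_pos hp hs0).ne'
    rw [← mul_assoc, hc, Nat.succ_sub_one, Nat.succ_mul, add_comm]
  have shift_le : Submodule.span k {w ^ (q * m) * f ^ (p * s - 1)} * L₁ m ≤ L (s * m) := by
    intro x hx
    obtain ⟨v, hv, rfl⟩ := Submodule.mem_span_singleton_mul.mp hx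
    rw [mul_assoc, mul_comm (w ^ _), mul_comm (f ^ _)]
    refine hmul _ (Submodule.mul_mem_mul ?_ ?_)
    · exact degree_eq ▸ SetLike.mul_mem_graded hv (SetLike.pow_mem_graded (p * s - 1) hf)
    · have := SetLike.pow_mem_graded (q * m) hw
      rwa [smul_eq_mul, mul_assoc, mul_comm m] at this
  calc Module.finrank k (L₁ m) ≤ Module.finrank k (L (s * m)) := by
        rw [← finrank_span_singleton_mul (mul_ne_zero (pow_ne_zero _ hw0) (pow_ne_zero _ hf0))]
        exact Submodule.finrank_mono shift_le
    _ ≤ C * (s * m + 1) ^ r := hC _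
    _ ≤ C * ((s + 1) * (m + 1)) ^ r := by
        gcongr
        nlinarith
    _ = C * (s + 1) ^ r * (m + 1) ^ r := by rw [mul_pow, mul_assoc]

lemma mul_limsup_dimRoot_add_le {r₁ r₂ : ℕ} (h : HasBrunnMinkowskiGrowth r L)
    (h₁ : HasBrunnMinkowskiGrowth r₁ L₁) (h₂ : HasBrunnMinkowskiGrowth r₂ L₂) (hn : 0 < n)
    (hr : n ≤ r) (hr₁ : n ≤ r₁) (hr₂ : n ≤ r₂) {g : ℕ} (hg : 0 < g) (hg₁ : g ∈ gradedSupport L₁)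
    (hg₂ : g ∈ gradedSupport L₂) :
    p * limsup (fun m : ℕ => dimRoot n (L₁ m) / m) atTop +
        q * limsup (fun m : ℕ => dimRoot n (L₂ m) / m) atTop ≤
      limsup (fun m : ℕ => dimRoot n (L m) / m) atTop := by
  obtain ⟨a, -, superadditive⟩ := h.exists_dimRoot_add_le hn hr
  have mul_mem {N : AddSubmonoid ℕ} (hg : g ∈ N) (c j : ℕ) : c * (g * j) ∈ N := by
    rw [mul_comm g, ← mul_assoc]
    exact N.nsmul_mem hg (c * j)
  calc p * limsup (fun m : ℕ => dimRoot n (L₁ m) / m) atTop +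
        q * limsup (fun m : ℕ => dimRoot n (L₂ m) / m) atTop
      ≤ liminf (fun j : ℕ => dimRoot n (L₁ (p * (g * j))) / (g * j + a : ℕ)) atTop +
        liminf (fun j : ℕ => dimRoot n (L₂ (q * (g * j))) / (g * j + a : ℕ)) atTop :=
        add_le_add (h₁.mul_limsup_dimRoot_le_liminf hn hr₁ hg₁ hg p a)
          (h₂.mul_limsup_dimRoot_le_liminf hn hr₂ hg₂ hg q a)
    _ ≤ liminf (fun j : ℕ => dimRoot n (L₁ (p * (g * j))) / (g * j + a : ℕ) +
        dimRoot n (L₂ (q * (g * j))) / (g * j + a : ℕ)) atTop := liminf_add_liminf_le _ _ _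
    _ ≤ liminf (fun j : ℕ => dimRoot n (L (g * j + a)) / (g * j + a : ℕ)) atTop := by
      refine liminf_le_liminf (Eventually.of_forall fun j => ?_)
      rw [ENNReal.div_add_div_same]
      gcongr
      exact superadditive _ _ _ (h₁.finiteDimensional _) (h₂.finiteDimensional _)
        (mul_mem hg₁ p j) (mul_mem hg₂ q j) (hmul _)
    _ ≤ limsup (fun j : ℕ => dimRoot n (L (g * j + a)) / (g * j + a : ℕ)) atTop :=
      liminf_le_limsup
    _ ≤ limsup (fun m : ℕ => dimRoot n (L m) / m) atTop :=
      Tendsto.limsup_comp_le_limsup (u := fun m : ℕ => dimRoot n (L m) / m)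
        (v := fun j => g * j + a) (tendsto_atTop_mono
          (fun j => Nat.le_add_right_of_le (Nat.le_mul_of_pos_left j hg)) tendsto_id)

theorem mul_limsup_add_mul_limsup_le (hn : 0 < n) (hp : 0 < p) {r₁ r₂ : ℕ}
    (h : HasBrunnMinkowskiGrowth r L) (h₁ : HasBrunnMinkowskiGrowth r₁ L₁)
    (h₂ : HasBrunnMinkowskiGrowth r₂ L₂)
    (hpos₁ : 0 < limsup (fun m : ℕ => (Module.finrank k (L₁ m) : ℝ≥0∞) / (m : ℝ≥0∞) ^ n) atTop)
    (hpos₂ : 0 < limsup (fun m : ℕ => (Module.finrank k (L₂ m) : ℝ≥0∞) / (m : ℝ≥0∞) ^ n) atTop) :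
    p * limsup (fun m : ℕ => dimRoot n (L₁ m) / m) atTop +
        q * limsup (fun m : ℕ => dimRoot n (L₂ m) / m) atTop ≤
      limsup (fun m : ℕ => dimRoot n (L m) / m) atTop := by
  obtain ⟨m₁, hm₁, hbot₁⟩ := exists_pos_ne_bot_of_limsup_pos hpos₁
  obtain ⟨m₂, hm₂, hbot₂⟩ := exists_pos_ne_bot_of_limsup_pos hpos₂
  have mem₁ : m₁ ∈ gradedSupport L₁ := hbot₁
  have mem₂ : m₂ ∈ gradedSupport L₂ := hbot₂
  obtain ⟨C₁, hC₁⟩ := h₁.exists_finrank_le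
  obtain ⟨C₂, hC₂⟩ := h₂.exists_finrank_le
  obtain ⟨C, hC⟩ := h.exists_finrank_le_of_mul_le hmul hp hm₂ mem₂
  exact h.mul_limsup_dimRoot_add_le hmul h₁ h₂ hn (le_of_limsup_div_pow_pos hC hpos₁)
    (le_of_limsup_div_pow_pos hC₁ hpos₁) (le_of_limsup_div_pow_pos hC₂ hpos₂) (mul_pos hm₁ hm₂)
    (by simpa only [smul_eq_mul, mul_comm] using nsmul_mem mem₁ m₂) (nsmul_mem mem₂ m₁)

end HasBrunnMinkowskiGrowth

end GradedLinearSeries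

/-! ### Homogeneous coordinates in the function field -/

section LocalRing

variable {X : Scheme.{u}} [IsIntegral X]

/-- The local ring `𝒪_{X,x}`, as a subring of the function field. -/
abbrev localRing (x : X) : Subring X.functionField :=
  (algebraMap (X.presheaf.stalk x) X.functionField).range

lemma genericPoint_mem_of_mem {U : X.Opens} {x : X} (hx : x ∈ U) : genericPoint X ∈ U :=
  ((genericPoint_spec X).mem_open_set_iff U.isOpen).mpr ⟨x, trivial, hx⟩

lemma germ_genericPoint_mem_localRing {U : X.Opens} {x : X} (hx : x ∈ U) (s : Γ(X, U)) :
    X.presheaf.germ U (genericPoint X) (genericPoint_mem_of_mem hx) s ∈ localRing x :=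
  have : Nonempty U := ⟨⟨x, hx⟩⟩
  ⟨_, Scheme.algebraMap_germ_eq_germToFunctionField X hx s⟩

lemma algebraMap_mem_localRing {k : Type u} [Field k] (π : X ⟶ Spec (CommRingCat.of k)) (c : k)
    (x : X) : letI := functionFieldAlgebra π; algebraMap k X.functionField c ∈ localRing x :=
  germ_genericPoint_mem_localRing (U := ⊤) trivial (constants π c)

lemma exists_germ_eq_of_forall_mem_localRing {U : X.Opens} (hU : IsAffineOpen U)
    (hη : genericPoint X ∈ U) {f : X.functionField} (hf : ∀ x ∈ U, f ∈ localRing x) :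
    ∃ s : Γ(X, U), X.presheaf.germ U (genericPoint X) hη s = f := by
  have : Nonempty U := ⟨⟨_, hη⟩⟩
  have := functionField_isFractionRing_of_isAffineOpen X U hU
  suffices f ∈ (⊥ : Subalgebra Γ(X, U) X.functionField) from Algebra.mem_bot.mp this
  rw [← PrimeSpectrum.iInf_localization_eq_bot, Algebra.mem_iInf]
  intro v
  have hx : hU.fromSpec v ∈ U := hU.range_fromSpec.le ⟨v, rfl⟩
  obtain ⟨t, rfl⟩ := hf _ hx
  let _ := TopCat.Presheaf.algebra_section_stalk X.presheaf (⟨_, hx⟩ : U)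
  have : IsLocalization.AtPrime (X.presheaf.stalk (hU.fromSpec v)) v.asIdeal :=
    hU.isLocalization_stalk' v hx
  have := functionField_isScalarTower X U ⟨_, hx⟩
  obtain ⟨⟨a, s⟩, has⟩ := IsLocalization.surj v.asIdeal.primeCompl t
  have ht := congrArg (algebraMap (X.presheaf.stalk (hU.fromSpec v)) X.functionField) has
  rw [map_mul, ← IsScalarTower.algebraMap_apply Γ(X, U) _ X.functionField,
    ← IsScalarTower.algebraMap_apply Γ(X, U) _ X.functionField] at ht
  have hs : algebraMap Γ(X, U) X.functionField s ≠ 0 := by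
    rw [Ne, IsFractionRing.to_map_eq_zero_iff]
    exact fun h => s.2 (h ▸ zero_mem _)
  exact ⟨a, s, s.2, (eq_mul_inv_iff_mul_eq₀ hs).mpr ht⟩

end LocalRing

/-! ### Standard charts of projective space -/

section Charts

open HomogeneousLocalization

attribute [local instance] MvPolynomial.gradedAlgebra

variable {k : Type u} [Field k] {N : ℕ}

local notation "𝓍" => (MvPolynomial.X : Fin (N + 1) → MvPolynomial (Fin (N + 1)) k)
local notation "𝒮" => MvPolynomial.homogeneousSubmodule (Fin (N + 1)) k

lemma X_mem_homogeneousSubmodule (i : Fin (N + 1)) : 𝓍 i ∈ 𝒮 1 :=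
  MvPolynomial.isHomogeneous_X k i

variable (k N) in
/-- The inclusion of the constants into the degree zero part of a localization of the polynomial
ring. -/
def homogeneousConst (S : Submonoid (MvPolynomial (Fin (N + 1)) k)) :
    k →+* HomogeneousLocalization 𝒮 S :=
  (fromZeroRingHom _ S).comp (algebraMap k (𝒮 0))

/-- The affine coordinate `x_j / x_i` on the chart `x_i ≠ 0` of projective space. -/
def affineCoord (i j : Fin (N + 1)) : Away 𝒮 (𝓍 i) :=
  Away.mk _ (X_mem_homogeneousSubmodule i) 1 (𝓍 j) (X_mem_homogeneousSubmodule j)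

lemma affineCoord_self (i : Fin (N + 1)) : (affineCoord i i : Away 𝒮 (𝓍 i)) = 1 := by
  apply val_injective
  rw [affineCoord, Away.val_mk, val_one, ← Localization.mk_one, Localization.mk_eq_mk_iff,
    Localization.r_iff_exists]
  exact ⟨1, by simp⟩

lemma algebraMap_X_mul_val_affineCoord (i j : Fin (N + 1)) :
    algebraMap (MvPolynomial (Fin (N + 1)) k) (Localization.Away (𝓍 i)) (𝓍 i) *
        (affineCoord i j).val =
      algebraMap (MvPolynomial (Fin (N + 1)) k) _ (𝓍 j) := by
  rw [affineCoord, Away.val_mk, Localization.mk_eq_mk', mul_comm]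
  simp

lemma eval₂_mul_of_isHomogeneous {σ R S : Type*} [CommSemiring R] [CommSemiring S] (φ : R →+* S)
    (t : S) (g : σ → S) {n : ℕ} {a : MvPolynomial σ R} (ha : a.IsHomogeneous n) :
    a.eval₂ φ (fun j => t * g j) = t ^ n * a.eval₂ φ g := by
  simp only [MvPolynomial.eval₂_eq, Finset.mul_sum]
  refine Finset.sum_congr rfl fun d hd => ?_
  have degree_eq : ∑ i ∈ d.support, d i = n := by
    simpa [Finsupp.weight_apply, Finsupp.sum] using ha (MvPolynomial.mem_support_iff.mp hd)
  simp only [mul_pow, Finset.prod_mul_distrib, Finset.prod_pow_eq_pow_sum, degree_eq]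
  ring

lemma away_mk_eq_eval₂ (i : Fin (N + 1)) (n : ℕ) (a : MvPolynomial (Fin (N + 1)) k)
    (ha : a ∈ 𝒮 (n • 1)) :
    Away.mk _ (X_mem_homogeneousSubmodule i) n a ha =
      a.eval₂ (homogeneousConst k N _) (affineCoord i) := by
  apply val_injective
  let loc := algebraMap (MvPolynomial (Fin (N + 1)) k) (Localization.Away (𝓍 i))
  have val_eval₂ : (a.eval₂ (homogeneousConst k N _) (affineCoord i) : Away 𝒮 (𝓍 i)).val =
      a.eval₂ (loc.comp MvPolynomial.C) fun j => (affineCoord i j).val := by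
    change algebraMap (Away 𝒮 (𝓍 i)) (Localization.Away (𝓍 i)) _ = _
    rw [MvPolynomial.hom_eval₂]
    rfl
  have homogeneity := eval₂_mul_of_isHomogeneous (loc.comp MvPolynomial.C) (loc (𝓍 i))
    (fun j => (affineCoord i j : Away 𝒮 (𝓍 i)).val) (by simpa using ha : a.IsHomogeneous n)
  simp only [loc, algebraMap_X_mul_val_affineCoord] at homogeneity
  rw [← MvPolynomial.hom_eval₂, MvPolynomial.eval₂_eta, mul_comm] at homogeneity
  rw [val_eval₂, Away.val_mk, Localization.mk_eq_mk', IsLocalization.mk'_eq_iff_eq_mul, homogeneity,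
    map_pow]

lemma awayMap_affineCoord_mul (i j l : Fin (N + 1)) :
    awayMap 𝒮 (X_mem_homogeneousSubmodule j) rfl (affineCoord i l) *
        awayMap 𝒮 (X_mem_homogeneousSubmodule i) (mul_comm _ _) (affineCoord j i) =
      awayMap 𝒮 (X_mem_homogeneousSubmodule i) (mul_comm _ _) (affineCoord j l) := by
  apply val_injective
  simp only [affineCoord, awayMap_mk, val_mul, Away.val_mk, Localization.mk_mul]
  rw [Localization.mk_eq_mk_iff, Localization.r_iff_exists]
  refine ⟨1, ?_⟩
  simp only [OneMemClass.coe_one, one_mul, Submonoid.coe_mul, pow_one]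
  ring

lemma mem_basicOpen_of_mem_basicOpen_affineCoord {i j : Fin (N + 1)} {p : projSpace k N}
    (hp : p ∈ (projSpace k N).basicOpen (Proj.awayToSection 𝒮 (𝓍 i) (affineCoord i j))) :
    p ∈ Proj.basicOpen 𝒮 (𝓍 j) := by
  have hpi := Scheme.basicOpen_le _ _ hp
  rw [Scheme.mem_basicOpen _ _ _ hpi] at hp
  have : p.asHomogeneousIdeal.toIdeal.IsPrime := p.isPrime
  have isUnit_val := (hp.map (Proj.stalkIso 𝒮 p).hom.hom).map (algebraMap
    (AtPrime 𝒮 p.asHomogeneousIdeal.toIdeal) (Localization.AtPrime p.asHomogeneousIdeal.toIdeal))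
  have val_eq := (congrArg val (Proj.stalkIso'_germ 𝒮 _ p hpi
    (Proj.awayToSection 𝒮 (𝓍 i) (affineCoord i j)))).trans
    (ProjectiveSpectrum.Proj.awayToSection_apply _ (𝓍 i) (affineCoord i j) ⟨p, hpi⟩)
  replace isUnit_val := (congrArg IsUnit val_eq).mp isUnit_val
  rw [affineCoord, Away.val_mk, Localization.mk_eq_mk', IsLocalization.map_mk'] at isUnit_val
  exact (IsLocalization.AtPrime.isUnit_mk'_iff _ p.asHomogeneousIdeal.toIdeal _ _).mp isUnit_val

lemma basicOpen_ι_comp_projSpaceToSpec {f : MvPolynomial (Fin (N + 1)) k} (hf : f ∈ 𝒮 1) :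
    (Proj.basicOpen 𝒮 f).ι ≫ projSpaceToSpec k N =
      Proj.basicOpenToSpec _ f ≫ Spec.map (CommRingCat.ofHom (homogeneousConst k N _)) := by
  have h := Proj.awayι_toSpecZero 𝒮 f hf one_pos
  rw [Proj.awayι, Category.assoc, Iso.inv_comp_eq, Proj.basicOpenIsoSpec_hom] at h
  rw [projSpaceToSpec, reassoc_of% h, homogeneousConst, CommRingCat.ofHom_comp, Spec.map_comp]

lemma constants_comp_awayToSection {f : MvPolynomial (Fin (N + 1)) k} (hf : f ∈ 𝒮 1) :
    (Scheme.ΓSpecIso (CommRingCat.of k)).inv ≫ (projSpaceToSpec k N).appTop ≫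
        (projSpace k N).presheaf.map (homOfLE le_top).op =
      CommRingCat.ofHom (homogeneousConst k N _) ≫ Proj.awayToSection 𝒮 f := by
  have h := congrArg (fun g => (Scheme.ΓSpecIso (CommRingCat.of k)).inv ≫ g.appTop)
    (basicOpen_ι_comp_projSpaceToSpec hf)
  have appTop_eq : (Proj.basicOpenToSpec 𝒮 f).appTop = _ := Proj.basicOpenToSpec_app_top 𝒮 f
  simp only [Scheme.Hom.comp_appTop] at h
  rw [appTop_eq, ← Scheme.ΓSpecIso_inv_naturality_assoc, Iso.inv_hom_id_assoc] at h
  rw [← cancel_mono (Scheme.Opens.topIso _).inv]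
  simp only [Category.assoc]
  rw [← h]
  simp only [Scheme.Opens.topIso_inv, Scheme.Opens.ι_appTop]
  rfl

variable {X : Scheme.{u}} (ι : X ⟶ projSpace k N)

/-- The open subset of a subscheme `ι` of projective space where the `i`-th coordinate does not
vanish. -/
def chart (i : Fin (N + 1)) : X.Opens := ι ⁻¹ᵁ Proj.basicOpen 𝒮 (𝓍 i)

lemma exists_mem_chart (x : X) : ∃ i, x ∈ chart ι i := by
  have adjoin_X_eq_top : Algebra.adjoin (𝒮 0) (Set.range 𝓍) = ⊤ := by
    refine eq_top_iff.mpr fun p _ => ?_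
    induction p using MvPolynomial.induction_on with
    | C a => exact Subalgebra.algebraMap_mem _ (algebraMap k (𝒮 0) a)
    | add p q hp hq => exact add_mem (hp trivial) (hq trivial)
    | mul_X p i hp => exact mul_mem (hp trivial) (Algebra.subset_adjoin ⟨i, rfl⟩)
  have cover : ι x ∈ ⨆ i, Proj.basicOpen 𝒮 (𝓍 i) :=
    (Proj.iSup_basicOpen_eq_top' 𝒮 𝓍 (fun i => ⟨1, X_mem_homogeneousSubmodule i⟩)
      adjoin_X_eq_top).ge trivial
  obtain ⟨i, hi⟩ := TopologicalSpace.Opens.mem_iSup.mp cover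
  exact ⟨i, hi⟩

lemma isAffineOpen_chart [IsClosedImmersion ι] (i : Fin (N + 1)) : IsAffineOpen (chart ι i) :=
  (Proj.isAffineOpen_basicOpen 𝒮 (𝓍 i) (X_mem_homogeneousSubmodule i) one_pos).preimage ι

include ι in
lemma compactSpace_of_isClosedImmersion [IsClosedImmersion ι] : CompactSpace X := by
  have cover : (Set.univ : Set X) = ⋃ i, (chart ι i : Set X) :=
    (Set.eq_univ_of_forall fun x => Set.mem_iUnion.mpr (exists_mem_chart ι x)).symm
  exact ⟨cover ▸ isCompact_iUnion fun i => (isAffineOpen_chart ι i).isCompact⟩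

/-- The pullback along `ι` of the degree zero fractions with denominators powers of `f`. -/
def awayToChart (f : MvPolynomial (Fin (N + 1)) k) :
    Away 𝒮 f →+* Γ(X, ι ⁻¹ᵁ Proj.basicOpen 𝒮 f) :=
  (Proj.awayToSection _ f ≫ ι.app _).hom

lemma awayToChart_surjective [IsClosedImmersion ι] (i : Fin (N + 1)) :
    Function.Surjective (awayToChart ι (𝓍 i)) :=
  (ι.app_surjective _
    (Proj.isAffineOpen_basicOpen 𝒮 (𝓍 i) (X_mem_homogeneousSubmodule i) one_pos)).comp
  (ConcreteCategory.bijective_of_isIso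
    (Proj.basicOpenIsoAway 𝒮 (𝓍 i) (X_mem_homogeneousSubmodule i) one_pos).hom).2

lemma germ_awayToChart_awayMap {f g h : MvPolynomial (Fin (N + 1)) k} (hg : g ∈ 𝒮 1)
    (hh : h = f * g) {x : X} (hf : x ∈ ι ⁻¹ᵁ Proj.basicOpen 𝒮 f)
    (hx : x ∈ ι ⁻¹ᵁ Proj.basicOpen 𝒮 h) (a : Away 𝒮 f) :
    X.presheaf.germ _ x hx (awayToChart ι h (awayMap _ hg hh a)) =
      X.presheaf.germ _ x hf (awayToChart ι f a) := by
  have restrict := ConcreteCategory.congr_hom (Proj.awayMap_awayToSection 𝒮 hg hh) a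
  have naturality := ConcreteCategory.congr_hom
    (ι.naturality (homOfLE (Proj.basicOpen_mono 𝒮 _ _ ⟨_, hh⟩)).op) (Proj.awayToSection _ f a)
  exact (congrArg (X.presheaf.germ _ x hx) ((congrArg (ι.app _) restrict).trans naturality)).trans
    (X.presheaf.germ_res_apply _ _ _ _)

lemma germ_constants {f : MvPolynomial (Fin (N + 1)) k} (hf : f ∈ 𝒮 1) (c : k) {x : X}
    (hx : x ∈ ι ⁻¹ᵁ Proj.basicOpen 𝒮 f) :
    X.presheaf.germ ⊤ x trivial (constants (ι ≫ projSpaceToSpec k N) c) =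
      X.presheaf.germ _ x hx (awayToChart ι f (homogeneousConst k N _ c)) := by
  have constants_eq := ConcreteCategory.congr_hom (constants_comp_awayToSection hf) c
  have naturality := ConcreteCategory.congr_hom
    (ι.naturality (homOfLE (le_top : Proj.basicOpen 𝒮 f ≤ ⊤)).op)
    ((projSpaceToSpec k N).appTop ((Scheme.ΓSpecIso (CommRingCat.of k)).inv c))
  rw [← X.presheaf.germ_res_apply (homOfLE le_top) x hx]
  refine congrArg (X.presheaf.germ _ x hx)
    (Eq.trans ?_ (naturality.symm.trans (congrArg (ι.app _) constants_eq)))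
  simp only [constants, Scheme.Hom.comp_appTop]
  rfl

section

variable [IsIntegral X]

/-- The restriction of `x_j / x_i` to a subvariety of projective space that meets the chart
`x_i ≠ 0`. -/
def chartCoord (i j : Fin (N + 1)) (hi : genericPoint X ∈ chart ι i) : X.functionField :=
  X.presheaf.germ _ _ hi (awayToChart ι (𝓍 i) (affineCoord i j))

lemma chartCoord_self (i : Fin (N + 1)) (hi : genericPoint X ∈ chart ι i) :
    chartCoord ι i i hi = 1 := by
  rw [chartCoord, affineCoord_self, map_one]
  exact map_one (X.presheaf.germ _ _ hi).hom

lemma chartCoord_mul (i j l : Fin (N + 1)) (hi : genericPoint X ∈ chart ι i)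
    (hj : genericPoint X ∈ chart ι j) :
    chartCoord ι i l hi * chartCoord ι j i hj = chartCoord ι j l hj := by
  have hij : genericPoint X ∈ ι ⁻¹ᵁ Proj.basicOpen 𝒮 (𝓍 i * 𝓍 j) := by
    rw [Proj.basicOpen_mul]
    exact ⟨hi, hj⟩
  have h := congrArg (fun a => X.presheaf.germ _ _ hij (awayToChart ι _ a))
    (awayMap_affineCoord_mul (k := k) i j l)
  simp only [map_mul] at h
  rwa [germ_awayToChart_awayMap ι _ _ hi, germ_awayToChart_awayMap ι _ _ hj,
    germ_awayToChart_awayMap ι _ _ hj] at h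

lemma chartCoord_div (i j l : Fin (N + 1)) (hi : genericPoint X ∈ chart ι i)
    (hj : genericPoint X ∈ chart ι j) :
    chartCoord ι j l hj / chartCoord ι j i hj = chartCoord ι i l hi := by
  have h := chartCoord_mul ι i j j hi hj
  rw [chartCoord_self] at h
  rw [div_eq_iff (right_ne_zero_of_mul_eq_one h), chartCoord_mul]

lemma genericPoint_mem_chart_of_chartCoord_ne_zero {i j : Fin (N + 1)}
    {hi : genericPoint X ∈ chart ι i} (h : chartCoord ι i j hi ≠ 0) :
    genericPoint X ∈ chart ι j := by
  refine mem_basicOpen_of_mem_basicOpen_affineCoord (i := i) (p := ι (genericPoint X)) ?_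
  have mem : genericPoint X ∈
      X.basicOpen (ι.app _ (Proj.awayToSection 𝒮 (𝓍 i) (affineCoord i j))) :=
    (Scheme.mem_basicOpen _ _ _ hi).mpr (isUnit_iff_ne_zero.mpr h)
  rwa [← Scheme.preimage_basicOpen] at mem

lemma germ_awayToChart_mem_adjoin (i : Fin (N + 1)) (hi : genericPoint X ∈ chart ι i)
    (a : Away 𝒮 (𝓍 i)) :
    letI := functionFieldAlgebra (ι ≫ projSpaceToSpec k N)
    X.presheaf.germ _ _ hi (awayToChart ι (𝓍 i) a) ∈
      Algebra.adjoin k (Set.range fun j => chartCoord ι i j hi) := by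
  let _ := functionFieldAlgebra (ι ≫ projSpaceToSpec k N)
  obtain ⟨n, b, hb, rfl⟩ := Away.mk_surjective _ (X_mem_homogeneousSubmodule i) a
  rw [away_mk_eq_eval₂, Algebra.adjoin_range_eq_range_aeval]
  refine ⟨b, Eq.symm ?_⟩
  change ((X.presheaf.germ _ _ hi).hom.comp (awayToChart ι (𝓍 i))) _ = b.aeval _
  rw [MvPolynomial.hom_eval₂, MvPolynomial.aeval_def]
  congr 1
  ext c
  exact (germ_constants ι (X_mem_homogeneousSubmodule i) c hi).symm

lemma germ_chart_mem_adjoin [IsClosedImmersion ι] (i : Fin (N + 1))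
    (hi : genericPoint X ∈ chart ι i) (s : Γ(X, chart ι i)) :
    letI := functionFieldAlgebra (ι ≫ projSpaceToSpec k N)
    X.presheaf.germ _ _ hi s ∈ Algebra.adjoin k (Set.range fun j => chartCoord ι i j hi) := by
  obtain ⟨a, rfl⟩ := awayToChart_surjective ι i s
  exact germ_awayToChart_mem_adjoin ι i hi a

lemma adjoin_range_chartCoord_eq_top [IsClosedImmersion ι] (i : Fin (N + 1))
    (hi : genericPoint X ∈ chart ι i) :
    letI := functionFieldAlgebra (ι ≫ projSpaceToSpec k N)
    IntermediateField.adjoin k (Set.range fun j => chartCoord ι i j hi) = ⊤ := by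
  let _ := functionFieldAlgebra (ι ≫ projSpaceToSpec k N)
  refine eq_top_iff.mpr fun f _ => ?_
  have : Nonempty (chart ι i) := ⟨⟨_, hi⟩⟩
  have := functionField_isFractionRing_of_isAffineOpen X _ (isAffineOpen_chart ι i)
  obtain ⟨a, b, -, rfl⟩ := IsFractionRing.div_surjective (A := Γ(X, chart ι i)) f
  have mem_adjoin (s : Γ(X, chart ι i)) : algebraMap _ X.functionField s ∈
      IntermediateField.adjoin k (Set.range fun j => chartCoord ι i j hi) :=
    IntermediateField.algebra_adjoin_le_adjoin k _ (germ_chart_mem_adjoin ι i hi s)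
  exact div_mem (mem_adjoin a) (mem_adjoin b)

end

end Charts

/-- Homogeneous coordinates of a projective variety, as elements of its function field obtained by
dividing by one of them that does not vanish identically. The variety is covered by the open sets
`domain i` where the `i`-th coordinate does not vanish; if this set is not empty, its ring of
regular functions is generated by the quotients `coord j / coord i`. -/
structure ProjectiveCoordinates {k : Type u} [Field k] {X : Scheme.{u}} [IsIntegral X]
    (π : X ⟶ Spec (CommRingCat.of k)) (N : ℕ) where
  coord : Fin (N + 1) → X.functionField
  domain : Fin (N + 1) → X.Opens
  exists_coord_eq_one : ∃ i, coord i = 1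
  exists_mem_domain : ∀ x, ∃ i, x ∈ domain i
  div_mem_localRing : ∀ {i x}, x ∈ domain i → ∀ j, coord j / coord i ∈ localRing x
  mem_adjoin : letI := functionFieldAlgebra π
    ∀ {i}, coord i ≠ 0 → ∀ {f : X.functionField}, (∀ x ∈ domain i, f ∈ localRing x) →
      f ∈ Algebra.adjoin k (Set.range fun j => coord j / coord i)
  adjoin_range_eq_top : letI := functionFieldAlgebra π
    IntermediateField.adjoin k (Set.range coord) = ⊤

section Projective

variable {k : Type u} [Field k] {X : Scheme.{u}} {π : X ⟶ Spec (CommRingCat.of k)}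

lemma IsProjectiveOver.compactSpace (hπ : IsProjectiveOver π) : CompactSpace X := by
  obtain ⟨N, ι, _, -⟩ := hπ
  exact compactSpace_of_isClosedImmersion ι

lemma IsProjectiveOver.exists_projectiveCoordinates [IsIntegral X] (hπ : IsProjectiveOver π) :
    ∃ N, Nonempty (ProjectiveCoordinates π N) := by
  obtain ⟨N, ι, _, rfl⟩ := hπ
  obtain ⟨i₀, hi₀⟩ := exists_mem_chart ι (genericPoint X)
  refine ⟨N, ⟨{
    coord := fun j => chartCoord ι i₀ j hi₀
    domain := chart ι
    exists_coord_eq_one := ⟨i₀, chartCoord_self ι i₀ hi₀⟩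
    exists_mem_domain := exists_mem_chart ι
    div_mem_localRing := fun {i x} hx j => ?_
    mem_adjoin := fun {i} hi f hf => ?_
    adjoin_range_eq_top := adjoin_range_chartCoord_eq_top ι i₀ hi₀ }⟩⟩
  · rw [chartCoord_div ι i i₀ j (genericPoint_mem_of_mem hx)]
    exact germ_genericPoint_mem_localRing hx _
  · have hηi := genericPoint_mem_chart_of_chartCoord_ne_zero ι hi
    obtain ⟨s, rfl⟩ := exists_germ_eq_of_forall_mem_localRing (isAffineOpen_chart ι i) hηi hf
    simp only [chartCoord_div ι i i₀ _ hηi]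
    exact germ_chart_mem_adjoin ι i hηi s

end Projective

/-! ### Sections of multiples of a Cartier divisor -/

section Cartier

variable {k : Type u} [Field k] {X : Scheme.{u}} [IsIntegral X]

lemma exists_isLocalEquation (D : CartierDivisor X) (x : X) : ∃ d, IsLocalEquation D x d := by
  obtain ⟨U, hU, d, hd⟩ := D.toMul.2 x
  exact ⟨d, hd x hU⟩

lemma isLocalEquation_zero (x : X) : IsLocalEquation (0 : CartierDivisor X) x 1 := rfl

lemma IsLocalEquation.add {D E : CartierDivisor X} {x : X} {d e : (X.functionField)ˣ}
    (hd : IsLocalEquation D x d) (he : IsLocalEquation E x e) :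
    IsLocalEquation (D + E) x (d * e) := by
  unfold IsLocalEquation at *
  rw [QuotientGroup.mk_mul, ← hd, ← he]
  rfl

lemma IsLocalEquation.nsmul {D : CartierDivisor X} {x : X} {d : (X.functionField)ˣ}
    (hd : IsLocalEquation D x d) (m : ℕ) : IsLocalEquation (m • D) x (d ^ m) := by
  induction m with
  | zero => simpa only [zero_smul, pow_zero] using isLocalEquation_zero x
  | succ m ih =>
    rw [succ_nsmul, pow_succ]
    exact ih.add hd

lemma IsLocalEquation.mul_mem_localRing {D : CartierDivisor X} {x : X} {d e : (X.functionField)ˣ}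
    (hd : IsLocalEquation D x d) (he : IsLocalEquation D x e) {f : X.functionField}
    (hf : f * d ∈ localRing x) : f * e ∈ localRing x := by
  obtain ⟨v, hv⟩ := QuotientGroup.eq.mp (hd.symm.trans he)
  have e_eq : (e : X.functionField) = d * algebraMap (X.presheaf.stalk x) X.functionField v := by
    rw [← mul_inv_cancel_left d e, ← hv]
    rfl
  rw [e_eq, ← mul_assoc]
  exact mul_mem hf ⟨v, rfl⟩

variable (π : X ⟶ Spec (CommRingCat.of k))

lemma mul_mem_sections {D E : CartierDivisor X} {f g : X.functionField} (hf : f ∈ sections π D)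
    (hg : g ∈ sections π E) : f * g ∈ sections π (D + E) := by
  intro x e he
  obtain ⟨d₁, h₁⟩ := exists_isLocalEquation D x
  obtain ⟨d₂, h₂⟩ := exists_isLocalEquation E x
  refine (h₁.add h₂).mul_mem_localRing he ?_
  rw [Units.val_mul, mul_mul_mul_comm]
  exact mul_mem (hf x d₁ h₁) (hg x d₂ h₂)

lemma one_mem_sections_zero : (1 : X.functionField) ∈ sections π (0 : CartierDivisor X) :=
  fun x _ hd => (isLocalEquation_zero x).mul_mem_localRing hd (by simp [one_mem])

lemma gradedMonoid_sections (D : CartierDivisor X) : letI := functionFieldAlgebra π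
    SetLike.GradedMonoid fun m : ℕ => sections π (m • D) := by
  let _ := functionFieldAlgebra π
  exact
    { one_mem := by simpa only [zero_smul] using one_mem_sections_zero π
      mul_mem := fun i j f g hf hg => by
        rw [add_nsmul]
        exact mul_mem_sections π hf hg }

end Cartier

lemma exists_mul_pow_mem_of_mem_adjoin {k K ι : Type*} [Field k] [Field K] [Algebra k K]
    {Y : Submodule k K} {y : ι → K} (hy : ∀ j, y j ∈ Y) {t : K} (ht : t ∈ Y) (ht0 : t ≠ 0) {f : K}
    (hf : f ∈ Algebra.adjoin k (Set.range fun j => y j / t)) : ∃ M, f * t ^ M ∈ Y ^ M := by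
  have mul_pow_mem {f : K} {M : ℕ} (h : f * t ^ M ∈ Y ^ M) (c : ℕ) :
      f * t ^ (M + c) ∈ Y ^ (M + c) := by
    rw [pow_add, pow_add, ← mul_assoc]
    exact Submodule.mul_mem_mul h (Submodule.pow_mem_pow _ ht c)
  induction hf using Algebra.adjoin_induction with
  | mem x hx =>
    obtain ⟨j, rfl⟩ := hx
    exact ⟨1, by simpa only [pow_one, div_mul_cancel₀ _ ht0] using hy j⟩
  | algebraMap r => exact ⟨0, by simp [Algebra.algebraMap_eq_smul_one]⟩
  | add x z _ _ hx hz =>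
    obtain ⟨M, hM⟩ := hx
    obtain ⟨M', hM'⟩ := hz
    refine ⟨M + M', ?_⟩
    rw [add_mul]
    exact add_mem (mul_pow_mem hM M') (add_comm M' M ▸ mul_pow_mem hM' M)
  | mul x z _ _ hx hz =>
    obtain ⟨M, hM⟩ := hx
    obtain ⟨M', hM'⟩ := hz
    refine ⟨M + M', ?_⟩
    rw [pow_add, pow_add, mul_mul_mul_comm]
    exact Submodule.mul_mem_mul hM hM'

namespace ProjectiveCoordinates

variable {k : Type u} [Field k] {X : Scheme.{u}} [IsIntegral X]
  {π : X ⟶ Spec (CommRingCat.of k)} {N : ℕ} (c : ProjectiveCoordinates π N)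

/-- The space of linear forms in the coordinates. -/
def linearForms : letI := functionFieldAlgebra π; Submodule k X.functionField :=
  letI := functionFieldAlgebra π
  Submodule.span k (Set.range c.coord)

lemma coord_mem_linearForms (i : Fin (N + 1)) : c.coord i ∈ c.linearForms :=
  let _ := functionFieldAlgebra π
  Submodule.subset_span ⟨i, rfl⟩

lemma one_mem_linearForms : 1 ∈ c.linearForms := by
  obtain ⟨i, hi⟩ := c.exists_coord_eq_one
  exact hi ▸ c.coord_mem_linearForms i

lemma finiteDimensional_linearForms : letI := functionFieldAlgebra π
    FiniteDimensional k c.linearForms :=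
  let _ := functionFieldAlgebra π
  FiniteDimensional.span_of_finite k (Set.finite_range c.coord)

lemma adjoin_linearForms_eq_top : letI := functionFieldAlgebra π
    IntermediateField.adjoin k (c.linearForms : Set X.functionField) = ⊤ :=
  let _ := functionFieldAlgebra π
  top_le_iff.mp (c.adjoin_range_eq_top.ge.trans
    (IntermediateField.adjoin.mono k _ _ Submodule.subset_span))

include c in
lemma essFiniteType : letI := functionFieldAlgebra π
    Algebra.EssFiniteType k X.functionField := by
  let _ := functionFieldAlgebra π
  refine IntermediateField.fg_top_iff.mp ⟨(Set.finite_range c.coord).toFinset, ?_⟩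
  rw [Set.Finite.coe_toFinset, c.adjoin_range_eq_top]

lemma div_pow_mem_localRing {i : Fin (N + 1)} {x : X} (hx : x ∈ c.domain i) {e : ℕ}
    {g : X.functionField} :
    letI := functionFieldAlgebra π
    g ∈ c.linearForms ^ e → g / c.coord i ^ e ∈ localRing x := by
  let _ := functionFieldAlgebra π
  have smul_mem (r : k) {a : X.functionField} (ha : a ∈ localRing x) : r • a ∈ localRing x := by
    rw [Algebra.smul_def]
    exact mul_mem (algebraMap_mem_localRing π r x) ha
  have div_mem {l : X.functionField} (hl : l ∈ c.linearForms) : l / c.coord i ∈ localRing x := by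
    induction hl using Submodule.span_induction with
    | mem l hl =>
      obtain ⟨j, rfl⟩ := hl
      exact c.div_mem_localRing hx j
    | zero => exact (zero_div (c.coord i)).symm ▸ zero_mem _
    | add a b _ _ ha hb => exact add_div a b (c.coord i) ▸ add_mem ha hb
    | smul r a _ ha => exact (smul_div_assoc r a (c.coord i)).symm ▸ smul_mem r ha
  intro hg
  induction hg using Submodule.pow_induction_on_left' with
  | algebraMap r => simpa using algebraMap_mem_localRing π r x
  | add a b e _ _ ha hb => exact add_div a b (c.coord i ^ e) ▸ add_mem ha hb
  | mem_mul l hl e a _ ha =>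
    rw [pow_succ', mul_div_mul_comm]
    exact mul_mem (div_mem hl) ha

lemma mul_pow_mem_saturatedPow_of_forall_isLocalEquation {D : CartierDivisor X} {e : ℕ}
    {h : X.functionField} :
    letI := functionFieldAlgebra π
    (∀ x, ∃ d, IsLocalEquation D x d ∧ h / d ∈ c.linearForms ^ e) →
      ∀ m : ℕ, ∀ f ∈ sections π (m • D), f * h ^ m ∈ saturatedPow c.linearForms (e * m) := by
  let _ := functionFieldAlgebra π
  intro hh m f hf
  refine mem_saturatedPow_of_forall fun i => ?_
  by_cases hi : c.coord i = 0
  · exact ⟨1, by simp [hi]⟩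
  have dehomogenization_mem : f * h ^ m / c.coord i ^ (e * m) ∈
      Algebra.adjoin k (Set.range fun j => c.coord j / c.coord i) := by
    refine c.mem_adjoin hi fun x hx => ?_
    obtain ⟨d, hd, hhd⟩ := hh x
    have factor : f * h ^ m / c.coord i ^ (e * m) =
        f * ↑(d ^ m) * (h / d / c.coord i ^ e) ^ m := by
      rw [Units.val_pow_eq_pow_val, div_pow, div_pow, ← pow_mul, mul_assoc, ← mul_div_assoc,
        mul_div_cancel₀ _ (pow_ne_zero _ d.ne_zero), mul_div_assoc]
    rw [factor]
    exact mul_mem (hf x _ (hd.nsmul m)) (pow_mem (c.div_pow_mem_localRing hx hhd) m)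
  obtain ⟨M, hM⟩ := exists_mul_pow_mem_of_mem_adjoin c.coord_mem_linearForms
    (c.coord_mem_linearForms i) hi dehomogenization_mem
  have h_mul := Submodule.mul_mem_mul
    (Submodule.pow_mem_pow _ (c.coord_mem_linearForms i) (e * m)) hM
  refine ⟨M, ?_⟩
  rwa [← pow_add, ← mul_assoc, mul_div_cancel₀ _ (pow_ne_zero _ hi)] at h_mul

lemma exists_forall_isLocalEquation_div_mem [CompactSpace X] (D : CartierDivisor X) :
    letI := functionFieldAlgebra π
    ∃ e, ∃ h : X.functionField, h ≠ 0 ∧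
      ∀ x, ∃ d, IsLocalEquation D x d ∧ h / d ∈ c.linearForms ^ e := by
  let _ := functionFieldAlgebra π
  choose V hV d hd using D.toMul.2
  obtain ⟨t, ht⟩ := isCompact_univ.elim_finite_subcover (fun x => (V x : Set X))
    (fun x => (V x).isOpen) (fun x _ => Set.mem_iUnion.mpr ⟨x, hV x⟩)
  let W := Submodule.span k ((fun x => (d x : X.functionField)⁻¹) '' t)
  have mem_ratioField (w : X.functionField) : w ∈ ratioField fun n => c.linearForms ^ n :=
    adjoin_le_ratioField_pow c.one_mem_linearForms
      (c.adjoin_linearForms_eq_top ▸ IntermediateField.mem_top)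
  obtain ⟨e, h, -, h0, hW⟩ := exists_common_denominator (V := W)
    (Submodule.fg_span (t.finite_toSet.image _)) fun w _ => mem_ratioField w
  refine ⟨e, h, h0, fun x => ?_⟩
  obtain ⟨z, hz, hxz⟩ := Set.mem_iUnion₂.mp (ht (Set.mem_univ x))
  refine ⟨d z, hd z x hxz, ?_⟩
  rw [div_eq_mul_inv]
  exact hW (Submodule.mul_mem_mul (Submodule.mem_span_singleton_self h)
    (Submodule.subset_span ⟨z, hz, rfl⟩))

end ProjectiveCoordinates

section Volume

open Filter

open scoped ENNReal

variable {k : Type u} [Field k] {X : Scheme.{u}} [IsIntegral X] {π : X ⟶ Spec (CommRingCat.of k)}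
  (hπ : IsProjectiveOver π)

include hπ

lemma exists_hasBrunnMinkowskiGrowth_sections (D : CartierDivisor X) :
    letI := functionFieldAlgebra π
    haveI := gradedMonoid_sections π D
    ∃ r, HasBrunnMinkowskiGrowth r fun m => sections π (m • D) := by
  let _ := functionFieldAlgebra π
  have := gradedMonoid_sections π D
  have := hπ.compactSpace
  obtain ⟨N, ⟨c⟩⟩ := hπ.exists_projectiveCoordinates
  have := c.finiteDimensional_linearForms
  have := c.essFiniteType
  obtain ⟨e, h, h0, hD⟩ := c.exists_forall_isLocalEquation_div_mem D
  exact exists_hasBrunnMinkowskiGrowth c.one_mem_linearForms c.adjoin_linearForms_eq_top h0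
    (c.mul_pow_mem_saturatedPow_of_forall_isLocalEquation hD)

lemma vol_eq_limsup_finrank (n : ℕ) (D : CartierDivisor X) :
    letI := functionFieldAlgebra π
    vol π n D = n.factorial *
      limsup (fun m : ℕ => (Module.finrank k (sections π (m • D)) : ℝ≥0∞) / (m : ℝ≥0∞) ^ n)
        atTop := by
  let _ := functionFieldAlgebra π
  have := gradedMonoid_sections π D
  obtain ⟨r, growth⟩ := exists_hasBrunnMinkowskiGrowth_sections hπ D
  have dimSections_eq (m : ℕ) :
      dimSections π (m • D) = (Module.finrank k (sections π (m • D)) : ℕ∞) := by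
    have := growth.finiteDimensional m
    rw [dimSections, ← Module.finrank_eq_rank, Cardinal.toENat_nat]
  simp only [vol, dimSections_eq, ENat.toENNReal_coe]

lemma vol_rpow_eq_limsup_dimRoot {n : ℕ} (hn : 0 < n) (D : CartierDivisor X) :
    letI := functionFieldAlgebra π
    vol π n D ^ (1 / (n : ℝ)) = (n.factorial : ℝ≥0∞) ^ (1 / (n : ℝ)) *
      limsup (fun m : ℕ => dimRoot n (sections π (m • D)) / m) atTop := by
  let _ := functionFieldAlgebra π
  rw [vol_eq_limsup_finrank hπ, ENNReal.mul_rpow_of_nonneg _ _ (by positivity),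
    limsup_div_pow_rpow hn]
  rfl

theorem mul_vol_rpow_add_le {n : ℕ} (hn : 0 < n) {D₁ D₂ : CartierDivisor X}
    (h₁ : 0 < vol π n D₁) (h₂ : 0 < vol π n D₂) {p : ℕ} (hp : 0 < p) (q : ℕ) :
    p * vol π n D₁ ^ (1 / (n : ℝ)) + q * vol π n D₂ ^ (1 / (n : ℝ)) ≤
      vol π n (p • D₁ + q • D₂) ^ (1 / (n : ℝ)) := by
  let _ := functionFieldAlgebra π
  have := gradedMonoid_sections π
  obtain ⟨r, growth⟩ := exists_hasBrunnMinkowskiGrowth_sections hπ (p • D₁ + q • D₂)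
  obtain ⟨r₁, growth₁⟩ := exists_hasBrunnMinkowskiGrowth_sections hπ D₁
  obtain ⟨r₂, growth₂⟩ := exists_hasBrunnMinkowskiGrowth_sections hπ D₂
  have sections_mul_le (m : ℕ) : sections π ((p * m) • D₁) * sections π ((q * m) • D₂) ≤
      sections π (m • (p • D₁ + q • D₂)) := by
    have smul_eq : m • (p • D₁ + q • D₂) = (p * m) • D₁ + (q * m) • D₂ :=
      (nsmul_add (p • D₁) (q • D₂) m).trans
        (congrArg₂ (· + ·) (mul_nsmul D₁ p m).symm (mul_nsmul D₂ q m).symm)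
    rw [smul_eq]
    exact Submodule.mul_le.mpr fun f hf g hg => mul_mem_sections π hf hg
  rw [vol_eq_limsup_finrank hπ, CanonicallyOrderedAdd.mul_pos] at h₁ h₂
  simp only [vol_rpow_eq_limsup_dimRoot hπ hn]
  rw [mul_left_comm, mul_left_comm (q : ℝ≥0∞), ← mul_add]
  gcongr
  exact growth.mul_limsup_add_mul_limsup_le sections_mul_le hn hp growth₁ growth₂ h₁.2 h₂.2

end Volume

end BigDivisor

end

-- A growth exponent `n` below the dimension of `X` gives the volumes of divisors of Iitaka
-- dimension `n`.
theorem mainTheorem12_general {k : Type u} [Field k] {X : AlgebraicGeometry.Scheme.{u}}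
    [AlgebraicGeometry.IsIntegral X]
    (π : X ⟶ AlgebraicGeometry.Spec (CommRingCat.of k))
    (hπ : BigDivisor.IsProjectiveOver π)
    (n : ℕ) (hn : 0 < n)
    (D₁ D₂ : BigDivisor.CartierDivisor X)
    (h₁ : 0 < BigDivisor.vol π n D₁) (h₂ : 0 < BigDivisor.vol π n D₂) :
    BigDivisor.vol π n D₁ ^ (1 / (n : ℝ)) + BigDivisor.vol π n D₂ ^ (1 / (n : ℝ)) ≤
        BigDivisor.vol π n (D₁ + D₂) ^ (1 / (n : ℝ)) ∧
      ∀ p q : ℕ,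
        (p : ENNReal) * BigDivisor.vol π n D₁ ^ (1 / (n : ℝ)) +
            (q : ENNReal) * BigDivisor.vol π n D₂ ^ (1 / (n : ℝ)) ≤
          BigDivisor.vol π n (p • D₁ + q • D₂) ^ (1 / (n : ℝ)) := by
  refine ⟨?_, fun p q => ?_⟩
  · simpa using BigDivisor.mul_vol_rpow_add_le hπ hn h₁ h₂ one_pos 1
  rcases Nat.eq_zero_or_pos p with rfl | hp
  · rcases Nat.eq_zero_or_pos q with rfl | hq
    · simp
    · rw [add_comm, add_comm (0 • D₁)]
      exact BigDivisor.mul_vol_rpow_add_le hπ hn h₂ h₁ hq 0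
  · exact BigDivisor.mul_vol_rpow_add_le hπ hn h₁ h₂ hp q

theorem mainTheorem12 {k : Type u} [Field k] {X : AlgebraicGeometry.Scheme.{u}}
    [AlgebraicGeometry.IsIntegral X]
    (π : X ⟶ AlgebraicGeometry.Spec (CommRingCat.of k))
    (hπ : BigDivisor.IsProjectiveOver π)
    (n : ℕ) (hn : 0 < n) (hdim : topologicalKrullDim X = n)
    (D₁ D₂ : BigDivisor.CartierDivisor X)
    (h₁ : 0 < BigDivisor.vol π n D₁) (h₂ : 0 < BigDivisor.vol π n D₂) :
    BigDivisor.vol π n D₁ ^ (1 / (n : ℝ)) + BigDivisor.vol π n D₂ ^ (1 / (n : ℝ)) ≤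
        BigDivisor.vol π n (D₁ + D₂) ^ (1 / (n : ℝ)) ∧
      ∀ p q : ℕ,
        (p : ENNReal) * BigDivisor.vol π n D₁ ^ (1 / (n : ℝ)) +
            (q : ENNReal) * BigDivisor.vol π n D₂ ^ (1 / (n : ℝ)) ≤
          BigDivisor.vol π n (p • D₁ + q • D₂) ^ (1 / (n : ℝ)) :=
  mainTheorem12_general π hπ n hn D₁ D₂ h₁ h₂
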